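/- **Setting.** Let $\mathbb X$ be a smooth, compact, connected Riemannian manifold (without boundary) with geodesic distance $\rho$ and closed balls $B(x,s)$, and let $\mu$ be a Borel probability measure on $\mathbb X$. Let $\phi_0\equiv 1,\phi_1,\phi_2,\dots$ be continuous real functions on $\mathbb X$, orthonormal in $L^2(\mu)$, and let $0=\ell_0\le \ell_1\le\cdots$ be real numbers with $\ell_j\to\infty$. Assume that there are $\alpha>0$ and constants $C,\kappa>0$ such that $\mu(B(x,s))\le C s^\alpha$ for all $x\in\mathbb X$, $s>0$, and such that for all $0<t\le 1$ and $x,y\in\mathbb X$ the series $K_t(x,y)=\sum_{j\ge 0} e^{-\ell_j^2t}\phi_j(x)\phi_j(y)$ converges and $|K_t(x,y)|\le C t^{-\alpha/2}\exp(-\kappa\rho(x,y)^2/t)$. For real $L$ let $\Pi_L=\mathrm{span}_{\mathbb C}\{\phi_j:\ell_j\le L\}$, and let $\|\cdot\|_\infty$ be the norm of $L^\infty(\mu)$. *Product assumption:* $A\ge 2$ is a number such that, with $\epsilon_L=\sup_{\ell_j,\ell_k\le L}\inf_{P\in\Pi_{AL}}\|\phi_j\phi_k-P\|_\infty$, one has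 $L^{s}\epsilon_L\to0$ as $L\to\infty$ for every $s>0$. Let $X^\infty$ be the $L^\infty(\mu)$-closure of $\bigcup_L\Pi_L$ (its elements being represented by their continuous representatives), and $\langle f,\phi_k\rangle=\int f\phi_k\,d\mu$. For $r>0$, $W^\infty_r$ is the set of $f\in X^\infty$ for which there is a (necessarily unique) $g=:(\Delta^*)^rf\in X^\infty$ with $\langle g,\phi_k\rangle=(1+\ell_k)^r\langle f,\phi_k\rangle$ for all $k$. For $f\in X^\infty$ and $\delta>0$ put $\omega_r(\infty;f,\delta)=\inf\{\|f-f_1\|_\infty+\delta^r\|(\Delta^*)^rf_1\|_\infty: f_1\in W^\infty_r\}$. Let $h:\mathbb R\to\mathbb R$ be an even $C^\infty$ function, nonincreasing on $[0,\infty)$, with $h(t)=1$ for $|t|\le 1/2$ and $h(t)=0$ for $|t|\ge1$. For a (finite) signed Borel measure $\nu$ on $\mathbb X$ and $L>0$ put $$\sigma_L(\nu;f,x)=\int_{\mathbb X} f(y)\sum_{j\ge 0}h(\ell_j/L)\phi_j(x)\phi_j(y)\,d\nu(y).$$ For $d>0$, $\nu$ is *$d$-regular with constant $N$* if $|\nu|(B(x,s))\le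 N\{\mu(B(x,s))+d^\alpha\}$ for all $x\in\mathbb X$, $s>0$; it is a *quadrature measure of order $M$* if $\int P\,d\mu=\int P\,d\nu$ for all $P\in\Pi_M$. **Proposition 5.3 (c).** Let $r>0$, $N$ and $L_0>0$ be real numbers. There is a constant $c>0$, depending only on $r$, $N$, $L_0$ and on the setting ($\mathbb X,\mu,\{\phi_j\},\{\ell_j\},\alpha,A,h$), such that for every $L\ge L_0$ and every quadrature measure $\nu$ of order $AL$ that is $1/L$-regular with constant $N$: 1. for every $f\in W^\infty_r$, $$\|f-\sigma_L(\nu;f)\|_\infty\le cL^{-r}\{\|f\|_\infty+\|(\Delta^*)^rf\|_\infty\};$$ 2. for every $f\in X^\infty$, $\sigma_L(\nu;f)\in W^\infty_r$ and $$\|f-\sigma_L(\nu;f)\|_\infty+L^{-r}\|(\Delta^*)^r\sigma_L(\nu;f)\|_\infty\le c\{\omega_r(\infty;f,1/L)+L^{-r}\|f\|_\infty\}.$$ -/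

import Mathlib

open MeasureTheory Filter Topology Bundle
open scoped ENNReal ContDiff Manifold Bundle

noncomputable section

namespace DiffusionApprox

section Defs

variable {X : Type*} [MetricSpace X] [MeasurableSpace X]

/-- The standing assumptions on the system: `φ 0, φ 1, …` are continuous real functions, orthonormal
in `L²(μ)`, with `φ 0 = 1`, and `ℓ 0 ≤ ℓ 1 ≤ …` are real numbers with `ℓ 0 = 0` and `ℓ j → ∞`.
The system is not assumed to be complete. -/
structure IsDiffusionSystem (μ : Measure X) (φ : ℕ → X → ℝ) (ℓ : ℕ → ℝ) : Prop where
  continuous : ∀ j, Continuous (φ j)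
  orthonormal : ∀ j k, ∫ x, φ j x * φ k x ∂μ = if j = k then 1 else 0
  phi_zero : ∀ x, φ 0 x = 1
  ell_zero : ℓ 0 = 0
  ell_mono : Monotone ℓ
  ell_tendsto : Tendsto ℓ atTop atTop

/-- `μ (B(x, ρ)) ≤ C ρ ^ α` for all closed balls. -/
def BallMeasureCond (μ : Measure X) (α : ℝ) : Prop :=
  ∃ C : ℝ, ∀ x : X, ∀ ρ : ℝ, 0 < ρ →
    μ (Metric.closedBall x ρ) ≤ ENNReal.ofReal (C * ρ ^ α)

/-- The terms of the heat kernel `K_t(x, y) = ∑ j, exp (- ℓ_j ^ 2 t) φ_j(x) φ_j(y)`. -/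
def heatTerm (φ : ℕ → X → ℝ) (ℓ : ℕ → ℝ) (t : ℝ) (x y : X) (j : ℕ) : ℝ :=
  Real.exp (-(ℓ j) ^ 2 * t) * φ j x * φ j y

/-- The Gaussian upper bound on the heat kernel: for `0 < t ≤ 1` the series defining `K_t(x, y)`
converges, and `|K_t(x, y)| ≤ C t ^ (- α / 2) exp (- κ dist(x, y) ^ 2 / t)`. -/
def GaussianUpperBound (φ : ℕ → X → ℝ) (ℓ : ℕ → ℝ) (α : ℝ) : Prop :=
  ∃ C : ℝ, ∃ κ : ℝ, 0 < C ∧ 0 < κ ∧ ∀ t : ℝ, 0 < t → t ≤ 1 → ∀ x y : X,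
    Summable (heatTerm φ ℓ t x y) ∧
      |∑' j, heatTerm φ ℓ t x y j| ≤ C * t ^ (-α / 2) * Real.exp (-κ * dist x y ^ 2 / t)

/-- `Π_L`, the diffusion polynomials of degree at most `L`: the (complex) linear span of the
`φ_j` with `ℓ_j ≤ L`. -/
def diffPoly (φ : ℕ → X → ℝ) (ℓ : ℕ → ℝ) (L : ℝ) : Submodule ℂ (X → ℂ) :=
  Submodule.span ℂ {p | ∃ j, ℓ j ≤ L ∧ p = fun x => (φ j x : ℂ)}

/-- `dist(∞; f, Π_L)`, the distance of `f` to `Π_L` in `L^∞(μ)`. -/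
def distPoly (μ : Measure X) (φ : ℕ → X → ℝ) (ℓ : ℕ → ℝ) (f : X → ℂ) (L : ℝ) : ℝ≥0∞ :=
  ⨅ P ∈ diffPoly φ ℓ L, eLpNorm (fun x => f x - P x) ∞ μ

/-- `ε_L`, the supremum of `dist(∞; φ_j φ_k, Π_{AL})` over all `j, k` with `ℓ_j, ℓ_k ≤ L`. -/
def productError (μ : Measure X) (φ : ℕ → X → ℝ) (ℓ : ℕ → ℝ) (A L : ℝ) : ℝ≥0∞ :=
  ⨆ (j : ℕ) (k : ℕ) (_ : ℓ j ≤ L) (_ : ℓ k ≤ L),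
    distPoly μ φ ℓ (fun x => (φ j x : ℂ) * (φ k x : ℂ)) (A * L)

/-- The product assumption with parameter `A ≥ 2`: `L ^ s ε_L → 0` as `L → ∞`, for every `s > 0`. -/
def ProductAssumption (μ : Measure X) (φ : ℕ → X → ℝ) (ℓ : ℕ → ℝ) (A : ℝ) : Prop :=
  2 ≤ A ∧ ∀ s : ℝ, 0 < s →
    Tendsto (fun L : ℝ => ENNReal.ofReal (L ^ s) * productError μ φ ℓ A L) atTop (𝓝 0)

/-- The space `X^∞`: the closure of the diffusion polynomials in `L^∞(μ)`. Its elements are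
represented by their continuous representatives, so that they can be integrated against measures
other than `μ`. -/
def XInf (μ : Measure X) (φ : ℕ → X → ℝ) (ℓ : ℕ → ℝ) : Set (X → ℂ) :=
  {f | Continuous f ∧ ∀ ε : ℝ, 0 < ε → ∃ L : ℝ, ∃ P ∈ diffPoly φ ℓ L,
    eLpNorm (fun x => f x - P x) ∞ μ ≤ ENNReal.ofReal ε}

/-- The coefficient `⟨f, φ_k⟩ = ∫ f φ_k dμ`. -/
def coeff (μ : Measure X) (φ : ℕ → X → ℝ) (f : X → ℂ) (k : ℕ) : ℂ :=
  ∫ x, f x * (φ k x : ℂ) ∂μ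

/-- `f` belongs to the smoothness class `W^∞_r` and `g = (Δ^*)^r f`: both functions are in `X^∞`,
and `⟨g, φ_k⟩ = (1 + ℓ_k) ^ r ⟨f, φ_k⟩` for all `k`. The function `g` is determined by `f`
(see `IsDeltaStar.ae_eq`). -/
structure IsDeltaStar (μ : Measure X) (φ : ℕ → X → ℝ) (ℓ : ℕ → ℝ) (r : ℝ) (f g : X → ℂ) :
    Prop where
  left_mem : f ∈ XInf μ φ ℓ
  right_mem : g ∈ XInf μ φ ℓ
  coeff_eq : ∀ k, coeff μ φ g k = (((1 + ℓ k) ^ r : ℝ) : ℂ) * coeff μ φ f k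

/-- Uniqueness of `(Δ^*)^r f`, so that the relation `IsDeltaStar` describes a (partial) operator. -/
theorem IsDeltaStar.ae_eq [CompactSpace X] [BorelSpace X] {μ : Measure X} [IsProbabilityMeasure μ]
    {φ : ℕ → X → ℝ} {ℓ : ℕ → ℝ} (hsys : IsDiffusionSystem μ φ ℓ) {r : ℝ} {f g g' : X → ℂ}
    (hg : IsDeltaStar μ φ ℓ r f g) (hg' : IsDeltaStar μ φ ℓ r f g') : g =ᵐ[μ] g' := by
  have hint : ∀ u : X → ℂ, Continuous u → Integrable u μ := fun u hu =>
    hu.integrable_of_hasCompactSupport (HasCompactSupport.of_compactSpace u)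
  have hc := hg.right_mem.1
  have hc' := hg'.right_mem.1
  have hφ : ∀ j, Continuous fun x => (φ j x : ℂ) := fun j =>
    Complex.continuous_ofReal.comp (hsys.continuous j)
  set d : X → ℂ := fun x => g x - g' x with hd
  have hdc : Continuous d := hc.sub hc'
  have horth : ∀ k, ∫ x, d x * (φ k x : ℂ) ∂μ = 0 := by
    intro k
    have h1 : coeff μ φ g k = coeff μ φ g' k := by rw [hg.coeff_eq, hg'.coeff_eq]
    have h2 : ∫ x, d x * (φ k x : ℂ) ∂μ = coeff μ φ g k - coeff μ φ g' k := by
      unfold coeff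
      have i1 : Integrable (fun x => g x * (φ k x : ℂ)) μ := hint _ (hc.mul (hφ k))
      have i2 : Integrable (fun x => g' x * (φ k x : ℂ)) μ := hint _ (hc'.mul (hφ k))
      rw [← integral_sub i1 i2]
      simp only [hd, sub_mul]
    rw [h2, h1, sub_self]
  have hpoly : ∀ L, ∀ P ∈ diffPoly φ ℓ L,
      Continuous P ∧ ∫ x, d x * starRingEnd ℂ (P x) ∂μ = 0 := by
    intro L P hP
    induction hP using Submodule.span_induction with
    | mem p hp =>
      obtain ⟨j, -, rfl⟩ := hp
      exact ⟨hφ j, by simpa using horth j⟩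
    | zero => exact ⟨continuous_const, by simp⟩
    | add p q _ _ hp hq =>
      refine ⟨hp.1.add hq.1, ?_⟩
      simp only [Pi.add_apply, map_add, mul_add]
      have i1 : Integrable (fun x => d x * starRingEnd ℂ (p x)) μ :=
        hint _ (hdc.mul (Complex.continuous_conj.comp hp.1))
      have i2 : Integrable (fun x => d x * starRingEnd ℂ (q x)) μ :=
        hint _ (hdc.mul (Complex.continuous_conj.comp hq.1))
      rw [integral_add i1 i2, hp.2, hq.2, add_zero]
    | smul a p _ hp =>
      refine ⟨hp.1.const_smul a, ?_⟩
      have : ∀ x, d x * starRingEnd ℂ ((a • p) x) =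
          starRingEnd ℂ a * (d x * starRingEnd ℂ (p x)) := by
        intro x; simp only [Pi.smul_apply, smul_eq_mul, map_mul]; ring
      simp only [this]
      rw [integral_const_mul, hp.2, mul_zero]
  obtain ⟨M, hM⟩ := (isCompact_range hdc).isBounded.exists_norm_le
  have hM' : ∀ x, ‖d x‖ ≤ M := fun x => hM _ ⟨x, rfl⟩
  have hae : ∀ {u : X → ℂ} {ε : ℝ}, 0 < ε → eLpNorm u ∞ μ ≤ ENNReal.ofReal ε →
      ∀ᵐ x ∂μ, ‖u x‖ ≤ ε := by
    intro u ε hε hu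
    rw [eLpNorm_exponent_top] at hu
    filter_upwards [enorm_ae_le_eLpNormEssSup u μ] with x hx
    have := hx.trans hu
    rwa [← ofReal_norm, ENNReal.ofReal_le_ofReal_iff hε.le] at this
  have hkey : ∀ ε : ℝ, 0 < ε → ∫ x, ‖d x‖ ^ 2 ∂μ ≤ M * (2 * ε) := by
    intro ε hε
    obtain ⟨L, P, hP, hPε⟩ := hg.right_mem.2 ε hε
    obtain ⟨L', P', hP', hPε'⟩ := hg'.right_mem.2 ε hε
    obtain ⟨hPc, hP0⟩ := hpoly L P hP
    obtain ⟨hPc', hP0'⟩ := hpoly L' P' hP'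
    have e : ((∫ x, ‖d x‖ ^ 2 ∂μ : ℝ) : ℂ) =
        ∫ x, d x * starRingEnd ℂ ((g x - P x) - (g' x - P' x)) ∂μ := by
      rw [← integral_complex_ofReal]
      have : ∀ x, d x * starRingEnd ℂ ((g x - P x) - (g' x - P' x)) =
          ((‖d x‖ ^ 2 : ℝ) : ℂ) -
            (d x * starRingEnd ℂ (P x) - d x * starRingEnd ℂ (P' x)) := by
        intro x
        have h3 : ((‖d x‖ ^ 2 : ℝ) : ℂ) = d x * starRingEnd ℂ (d x) := by
          rw [Complex.mul_conj, Complex.normSq_eq_norm_sq]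
        rw [h3]; simp only [hd, map_sub]; ring
      simp only [this]
      have i1 : Integrable (fun x => d x * starRingEnd ℂ (P x)) μ :=
        hint _ (hdc.mul (Complex.continuous_conj.comp hPc))
      have i2 : Integrable (fun x => d x * starRingEnd ℂ (P' x)) μ :=
        hint _ (hdc.mul (Complex.continuous_conj.comp hPc'))
      have i3 : Integrable (fun x => ((‖d x‖ ^ 2 : ℝ) : ℂ)) μ :=
        hint _ (Complex.continuous_ofReal.comp (hdc.norm.pow 2))
      have i4 : Integrable (fun x => d x * starRingEnd ℂ (P x) - d x * starRingEnd ℂ (P' x)) μ :=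
        i1.sub i2
      rw [integral_sub i3 i4,
        integral_sub i1 i2, hP0, hP0', sub_zero, sub_zero]
    have hnn : 0 ≤ ∫ x, ‖d x‖ ^ 2 ∂μ := integral_nonneg fun x => by positivity
    have b : ‖∫ x, d x * starRingEnd ℂ ((g x - P x) - (g' x - P' x)) ∂μ‖ ≤
        M * (2 * ε) * μ.real Set.univ := by
      apply norm_integral_le_of_norm_le_const
      filter_upwards [hae hε hPε, hae hε hPε'] with x h1 h2
      rw [norm_mul, RCLike.norm_conj]
      have h4 := norm_sub_le (g x - P x) (g' x - P' x)
      have h5 := hM' x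
      have h6 := norm_nonneg (d x)
      exact mul_le_mul h5 (by linarith) (norm_nonneg _) (h6.trans h5)
    rw [← e, Complex.norm_real, Real.norm_of_nonneg hnn] at b
    simpa using b
  have hz : ∫ x, ‖d x‖ ^ 2 ∂μ = 0 := by
    refine le_antisymm ?_ (integral_nonneg fun x => by positivity)
    refine le_of_forall_pos_le_add fun η hη => ?_
    have hM0 : 0 ≤ |M| := abs_nonneg M
    have := hkey (η / (2 * (|M| + 1))) (by positivity)
    have h7 : M * (2 * (η / (2 * (|M| + 1)))) ≤ η := by
      have : M * (2 * (η / (2 * (|M| + 1)))) = (M / (|M| + 1)) * η := by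
        field_simp
      rw [this]
      have h8 : M / (|M| + 1) ≤ 1 := by
        rw [div_le_one (by positivity)]; linarith [le_abs_self M]
      nlinarith
    linarith
  have hi : Integrable (fun x => ‖d x‖ ^ 2) μ :=
    (hdc.norm.pow 2).integrable_of_hasCompactSupport (HasCompactSupport.of_compactSpace _)
  have := (integral_eq_zero_iff_of_nonneg (fun x => by positivity) hi).1 hz
  filter_upwards [this] with x hx
  have h9 : ‖d x‖ ^ 2 = 0 := hx
  have h10 : d x = 0 := by simpa using h9
  exact sub_eq_zero.1 h10

/-- The K-functional
`ω_r(∞; f, δ) = inf {‖f - f₁‖_∞ + δ ^ r ‖(Δ^*)^r f₁‖_∞ : f₁ ∈ W^∞_r}`. -/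
def kFunctional (μ : Measure X) (φ : ℕ → X → ℝ) (ℓ : ℕ → ℝ) (r : ℝ) (f : X → ℂ) (δ : ℝ) :
    ℝ≥0∞ :=
  ⨅ (f₁ : X → ℂ) (g₁ : X → ℂ) (_ : IsDeltaStar μ φ ℓ r f₁ g₁),
    eLpNorm (fun x => f x - f₁ x) ∞ μ + ENNReal.ofReal (δ ^ r) * eLpNorm g₁ ∞ μ

/-- The low-pass filter `h`: smooth, even, nonincreasing on `[0, ∞)`, equal to `1` on
`[-1/2, 1/2]` and to `0` outside `(-1, 1)`. -/
structure IsFilter (h : ℝ → ℝ) : Prop where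
  smooth : ContDiff ℝ ∞ h
  even : ∀ t, h (-t) = h t
  antitone : AntitoneOn h (Set.Ici 0)
  eq_one : ∀ t, |t| ≤ 1 / 2 → h t = 1
  eq_zero : ∀ t, 1 ≤ |t| → h t = 0

/-- `Φ_L(x, y) = ∑ j, h(ℓ_j / L) φ_j(x) φ_j(y)`, for `L > 0` (a finite sum, as `h` vanishes outside
`(-1, 1)` and `ℓ_j → ∞`). -/
def kernelPhi (φ : ℕ → X → ℝ) (ℓ : ℕ → ℝ) (h : ℝ → ℝ) (L : ℝ) (x y : X) : ℝ :=
  ∑' j, h (ℓ j / L) * φ j x * φ j y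

/-- The summability operator `σ_L(ν; f, x) = ∫ f(y) Φ_L(x, y) dν(y)` of a signed measure `ν`. -/
def sigmaOp (φ : ℕ → X → ℝ) (ℓ : ℕ → ℝ) (h : ℝ → ℝ) (L : ℝ) (ν : SignedMeasure X)
    (f : X → ℂ) (x : X) : ℂ :=
  ∫ᵛ y, f y * (kernelPhi φ ℓ h L x y : ℂ) ∂<•ν

/-- The signed measure `ν` is `d`-regular with constant `N`:
`|ν|(B(x, ρ)) ≤ N (μ(B(x, ρ)) + d ^ α)` for all closed balls. -/
def IsRegularMeasure (μ : Measure X) (α d N : ℝ) (ν : SignedMeasure X) : Prop :=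
  ∀ x : X, ∀ ρ : ℝ, 0 < ρ → ν.variation (Metric.closedBall x ρ) ≤
    ENNReal.ofReal N * (μ (Metric.closedBall x ρ) + ENNReal.ofReal (d ^ α))

/-- `ν` is a quadrature measure of order `L`: `∫ P dμ = ∫ P dν` for all `P ∈ Π_L`. -/
def IsQuadratureMeasure (μ : Measure X) (φ : ℕ → X → ℝ) (ℓ : ℕ → ℝ) (L : ℝ)
    (ν : SignedMeasure X) : Prop :=
  ∀ P ∈ diffPoly φ ℓ L, ∫ x, P x ∂μ = ∫ᵛ x, P x ∂<•ν

end Defs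

end DiffusionApprox

end

open DiffusionApprox

/-!
The estimates rest on the localization of kernels `∑ j, b(ℓ_j / M) φ_j(x) φ_j(y)` for smooth
compactly supported `b`, and the Gaussian bound yields it without finite propagation speed. With
`t = τ / M ^ 2` and `u_j = exp (-ℓ_j ^ 2 t)`, the symbol is `u_j ∑ k, a_k T_k(u_j)`, where `T_k` are
Chebyshev polynomials and the `a_k` decrease faster than any power, being the cosine coefficients
of a smooth function of `θ = arccos u` (`exists_chebyshev_series`). The part `k < n` combines the
heat kernels at times `t, …, n t` with coefficients `O(3 ^ n)`, and Gaussian decay absorbs this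
factor at distance `≥ D n √t`; the remainder is controlled by the decay of `a_k` and the diagonal
heat kernel bound (`HeatBound.exists_localized`). Integration over dyadic balls bounds the
`L¹`-norms of these kernels with respect to all `1 / M`-regular measures at once
(`HeatBound.exists_kernel_bound`).

The operators `σ_M(μ)` are therefore uniformly bounded, and the weighted bands
`(h(ℓ / 2M) - h(ℓ / M)) (1 + ℓ) ^ q` have norm `O(M ^ q)`. Summing bands over dyadic `M` gives
`‖f - σ_M(μ; f)‖ = O(M ^ (-r)) ‖(Δ^*)^r f‖` for `q = -r` (`HeatBound.exists_direct`), and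
`‖(Δ^*)^r P‖ = O(M ^ r) ‖P‖` on `Π_M` for `q = r` (`HeatBound.exists_bernstein`).

For a quadrature measure `ν`, the operators `σ_L(ν)` are bounded by the same kernel estimate, and
`σ_L(ν; P)` differs from `σ_L(μ; P)` by `O(L ^ (-r)) ‖P‖` for `P ∈ Π_L`: products `φ_j φ_k` are
close to `Π_{AL}`, where the quadrature is exact (`HeatBound.exists_quadrature_error`). Since `ν`
need not be absolutely continuous with respect to `μ`, this needs closeness everywhere and not just
`μ`-almost everywhere. It holds because `μ` has full support: a heat kernel centred off the support
would tend to `0` as `t → 0`, but has integral `1` (`HeatBound.isOpenPosMeasure`). Comparing `f`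
with `σ_{L/2}(μ; f)` gives the first estimate, and comparing with a competitor in the `K`-functional
gives the second.
-/

noncomputable section

namespace DiffusionApprox

/-! ### Cosine series of smooth periodic families -/

section

/-- The partial derivative in the second variable of a function of two real variables. -/
def deriv₂ (F : ℝ → ℝ → ℂ) (ε θ : ℝ) : ℂ := fderiv ℝ (Function.uncurry F) (ε, θ) (0, 1)

lemma contDiff_deriv₂ {F : ℝ → ℝ → ℂ} (hF : ContDiff ℝ ∞ (Function.uncurry F)) :
    ContDiff ℝ ∞ (Function.uncurry (deriv₂ F)) := by
  have h : ContDiff ℝ ∞ (fderiv ℝ (Function.uncurry F)) := hF.fderiv_right (by simp)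
  exact h.clm_apply contDiff_const

lemma hasDerivAt_deriv₂ {F : ℝ → ℝ → ℂ} (hF : ContDiff ℝ ∞ (Function.uncurry F)) (ε θ : ℝ) :
    HasDerivAt (F ε) (deriv₂ F ε θ) θ := by
  have h1 : HasFDerivAt (Function.uncurry F) (fderiv ℝ (Function.uncurry F) (ε, θ)) (ε, θ) :=
    (hF.differentiable (by simp) _).hasFDerivAt
  have h2 : HasDerivAt (fun θ : ℝ => (ε, θ)) ((0 : ℝ), (1 : ℝ)) θ :=
    (hasDerivAt_const θ ε).prodMk (hasDerivAt_id θ)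
  exact h1.comp_hasDerivAt θ h2

lemma periodic_deriv₂ {F : ℝ → ℝ → ℂ} (hF : ContDiff ℝ ∞ (Function.uncurry F)) {T : ℝ}
    (hper : ∀ ε θ, F ε (θ + T) = F ε θ) (ε θ : ℝ) : deriv₂ F ε (θ + T) = deriv₂ F ε θ := by
  have h1 := (hasDerivAt_deriv₂ hF ε (θ + T)).comp_add_const θ T
  have h2 : (fun θ => F ε (θ + T)) = F ε := funext (hper ε)
  rw [h2] at h1
  exact h1.unique (hasDerivAt_deriv₂ hF ε θ)

/-- Fourier coefficients decay faster than any power, uniformly in the parameter: integrate by parts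
`m` times, noting that `deriv₂ F` is again a smooth periodic family. -/
lemma fourierCoeffOn_decay (m : ℕ) (E : ℝ) : ∀ {F : ℝ → ℝ → ℂ},
    ContDiff ℝ ∞ (Function.uncurry F) → (∀ ε θ, F ε (θ + 2 * Real.pi) = F ε θ) →
    ∃ B : ℝ, 0 ≤ B ∧ ∀ ε ∈ Set.Icc 0 E, ∀ k : ℤ,
      ‖fourierCoeffOn Real.two_pi_pos (F ε) k‖ * |(k : ℝ)| ^ m ≤ B := by
  induction m with
  | zero =>
    intro F hF _
    obtain ⟨B, hB⟩ := ((isCompact_Icc (a := (0 : ℝ)) (b := E)).prod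
      (isCompact_Icc (a := (0 : ℝ)) (b := 2 * Real.pi))).exists_bound_of_continuousOn
      hF.continuous.continuousOn
    refine ⟨|B|, abs_nonneg B, fun ε hε k => ?_⟩
    have hb : ‖∫ x in (0 : ℝ)..2 * Real.pi,
        fourier (-k) (x : AddCircle (2 * Real.pi - 0)) • F ε x‖ ≤ |B| * |2 * Real.pi - 0| := by
      apply intervalIntegral.norm_integral_le_of_norm_le_const
      intro x hx
      rw [Set.uIoc_of_le Real.two_pi_pos.le] at hx
      have h2 := hB (ε, x) ⟨hε, hx.1.le, hx.2⟩
      rw [norm_smul, fourier_apply, Circle.norm_coe, one_mul]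
      exact h2.trans (le_abs_self B)
    rw [fourierCoeffOn_eq_integral, pow_zero, mul_one, norm_smul]
    have hp := Real.two_pi_pos
    rw [sub_zero, abs_of_pos hp] at hb
    rw [sub_zero, Real.norm_of_nonneg (by positivity)]
    calc _ ≤ 1 / (2 * Real.pi) * (|B| * (2 * Real.pi)) := by
          gcongr
      _ = |B| := by field_simp
  | succ m ih =>
    intro F hF hper
    obtain ⟨B, hB0, hB⟩ := ih (contDiff_deriv₂ hF) (periodic_deriv₂ hF hper)
    refine ⟨B, hB0, fun ε hε k => ?_⟩
    rcases eq_or_ne k 0 with rfl | hk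
    · simp [hB0]
    have hc : Continuous (deriv₂ F ε) :=
      (contDiff_deriv₂ hF).continuous.comp (Continuous.prodMk_right ε)
    have h1 := fourierCoeffOn_of_hasDerivAt Real.two_pi_pos hk
      (fun x _ => hasDerivAt_deriv₂ hF ε x) (hc.intervalIntegrable _ _)
    have h0 : F ε (2 * Real.pi) - F ε 0 = 0 := by
      have := hper ε 0
      rw [zero_add] at this
      rw [this, sub_self]
    have h2 : ‖fourierCoeffOn Real.two_pi_pos (F ε) k‖ * |(k : ℝ)| =
        ‖fourierCoeffOn Real.two_pi_pos (deriv₂ F ε) k‖ := by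
      rw [h1, h0]
      have hk' : |(k : ℝ)| ≠ 0 := by simpa using hk
      have hp : |Real.pi| ≠ 0 := by simp
      have hpp : Real.pi ≠ 0 := Real.pi_ne_zero
      simp [abs_of_pos Real.pi_pos]
      field_simp
    rw [pow_succ', ← mul_assoc, h2]
    exact hB ε hε k

/-- A smooth family of even `2π`-periodic functions has cosine series whose coefficients decay
faster than any power, uniformly for parameters in a compact interval. -/
lemma exists_cos_series {F : ℝ → ℝ → ℝ} (hF : ContDiff ℝ ∞ (Function.uncurry F))
    (hper : ∀ ε θ, F ε (θ + 2 * Real.pi) = F ε θ) (heven : ∀ ε θ, F ε (-θ) = F ε θ)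
    (E : ℝ) {S : ℕ} (hS : 2 ≤ S) :
    ∃ B : ℝ, 0 ≤ B ∧ ∀ ε ∈ Set.Icc 0 E, ∃ a : ℕ → ℝ, (∀ k : ℕ, |a k| ≤ B / (1 + k) ^ S) ∧
      ∀ θ, HasSum (fun k : ℕ => a k * Real.cos (k * θ)) (F ε θ) := by
  have hFc : ContDiff ℝ ∞ (Function.uncurry fun ε θ => (F ε θ : ℂ)) :=
    Complex.ofRealCLM.contDiff.comp hF
  have hperc : ∀ ε θ, (F ε (θ + 2 * Real.pi) : ℂ) = F ε θ := fun ε θ => by rw [hper]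
  obtain ⟨B₀, hB₀, h₀⟩ := fourierCoeffOn_decay 0 E hFc hperc
  obtain ⟨B₁, hB₁, h₁⟩ := fourierCoeffOn_decay S E hFc hperc
  refine ⟨3 * (2 ^ S * (B₀ + B₁)), by positivity, fun ε hε => ?_⟩
  set c : ℤ → ℂ := fourierCoeffOn Real.two_pi_pos (fun θ => (F ε θ : ℂ)) with hc
  have hdecay : ∀ k : ℤ, ‖c k‖ ≤ 2 ^ S * (B₀ + B₁) / (1 + |(k : ℝ)|) ^ S := by
    intro k
    rw [le_div_iff₀ (by positivity)]
    have e0 := h₀ ε hε k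
    have e1 := h₁ ε hε k
    rw [pow_zero, mul_one] at e0
    have hle : (1 + |(k : ℝ)|) ^ S ≤ 2 ^ S * (1 + |(k : ℝ)| ^ S) := by
      rcases le_total |(k : ℝ)| 1 with hk | hk
      · calc (1 + |(k : ℝ)|) ^ S ≤ 2 ^ S := by gcongr; linarith
          _ ≤ 2 ^ S * (1 + |(k : ℝ)| ^ S) := by
            have : (0 : ℝ) ≤ |(k : ℝ)| ^ S := by positivity
            nlinarith [pow_pos (zero_lt_two' ℝ) S]
      · calc (1 + |(k : ℝ)|) ^ S ≤ (2 * |(k : ℝ)|) ^ S := by gcongr; linarith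
          _ = 2 ^ S * |(k : ℝ)| ^ S := mul_pow _ _ _
          _ ≤ 2 ^ S * (1 + |(k : ℝ)| ^ S) := by gcongr; linarith
    calc ‖c k‖ * (1 + |(k : ℝ)|) ^ S ≤ ‖c k‖ * (2 ^ S * (1 + |(k : ℝ)| ^ S)) := by gcongr
      _ = 2 ^ S * (‖c k‖ + ‖c k‖ * |(k : ℝ)| ^ S) := by ring
      _ ≤ 2 ^ S * (B₀ + B₁) := by gcongr
  have hsq : Summable fun k : ℕ => 1 / ((1 : ℝ) + k) ^ S := by
    have := (summable_nat_add_iff 1).2 (Real.summable_one_div_nat_pow.2 (by omega : 1 < S))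
    refine this.congr fun k => ?_
    push_cast; rw [add_comm]
  have hsum : Summable c := by
    refine Summable.of_nat_of_neg ?_ ?_
    · refine Summable.of_norm_bounded (hsq.mul_left (2 ^ S * (B₀ + B₁))) fun k => ?_
      refine (hdecay k).trans_eq ?_
      simp [div_eq_mul_inv]
    · refine Summable.of_norm_bounded (hsq.mul_left (2 ^ S * (B₀ + B₁))) fun k => ?_
      refine (hdecay (-k)).trans_eq ?_
      simp [div_eq_mul_inv]
  have : Fact (0 < 2 * Real.pi) := ⟨Real.two_pi_pos⟩
  have hpe : Function.Periodic (fun θ => (F ε θ : ℂ)) (2 * Real.pi) := hperc ε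
  have hcont : Continuous (fun θ => (F ε θ : ℂ)) := hFc.continuous.comp (Continuous.prodMk_right ε)
  let G : C(AddCircle (2 * Real.pi), ℂ) :=
    ⟨hpe.lift, continuous_coinduced_dom.2 hcont⟩
  have hG : ∀ θ : ℝ, G θ = F ε θ := fun θ => rfl
  have hcoef : fourierCoeff G = c := by
    ext k
    rw [fourierCoeff_eq_intervalIntegral _ _ 0, hc, fourierCoeffOn_eq_integral]
    rw [zero_add, sub_zero]
    congr 1
  -- Averaging the series at `θ` and `-θ` removes the sine terms.
  have hser : ∀ θ : ℝ, HasSum (fun k : ℤ => (c k).re * Real.cos (k * θ)) (F ε θ) := by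
    have hone : ∀ θ : ℝ, HasSum (fun k : ℤ => (c k).re * Real.cos (k * θ) -
        (c k).im * Real.sin (k * θ)) (F ε θ) := by
      intro θ
      have h1 := has_pointwise_sum_fourier_series_of_summable (f := G) (by rwa [hcoef]) θ
      rw [hcoef, hG] at h1
      have h2 := Complex.hasSum_re h1
      rw [Complex.ofReal_re] at h2
      refine h2.congr_fun fun k => ?_
      rw [fourier_coe_apply]
      have : 2 * Real.pi * Complex.I * k * θ / ((2 * Real.pi : ℝ) : ℂ) =
          ((k * θ : ℝ) : ℂ) * Complex.I := by
        have : (Real.pi : ℂ) ≠ 0 := by exact_mod_cast Real.pi_ne_zero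
        push_cast; field_simp
      rw [this, smul_eq_mul, Complex.mul_re, Complex.exp_ofReal_mul_I_re,
        Complex.exp_ofReal_mul_I_im]
    intro θ
    have h3 := ((hone θ).add (hone (-θ))).div_const 2
    rw [heven, add_self_div_two] at h3
    refine h3.congr_fun fun k => ?_
    rw [mul_neg, Real.cos_neg, Real.sin_neg]; ring
  -- Folding `ℤ` onto `ℕ` counts the index `0` twice.
  refine ⟨fun n => (c n).re + (c (-n)).re - if n = 0 then (c 0).re else 0, ?_, ?_⟩
  · intro k
    have e1 : |(c k).re| ≤ 2 ^ S * (B₀ + B₁) / (1 + k) ^ S := by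
      refine ((Complex.abs_re_le_norm _).trans (hdecay k)).trans_eq ?_
      simp
    have e2 : |(c (-k)).re| ≤ 2 ^ S * (B₀ + B₁) / (1 + k) ^ S := by
      refine ((Complex.abs_re_le_norm _).trans (hdecay (-k))).trans_eq ?_
      simp
    have e3 : |if k = 0 then (c 0).re else 0| ≤ 2 ^ S * (B₀ + B₁) / (1 + k) ^ S := by
      split_ifs with hk
      · subst hk; simpa using e1
      · rw [abs_zero]; positivity
    have := abs_sub ((c k).re + (c (-k)).re) (if k = 0 then (c 0).re else 0)
    have h4 := abs_add_le (c k).re (c (-k)).re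
    have : 3 * (2 ^ S * (B₀ + B₁)) / (1 + (k : ℝ)) ^ S =
      3 * (2 ^ S * (B₀ + B₁) / (1 + k) ^ S) := by ring
    linarith
  · intro θ
    have h4 := (hser θ).nat_add_neg
    have h5 : HasSum (fun k : ℕ => if k = 0 then (c 0).re else 0) (c 0).re :=
      hasSum_ite_eq 0 _
    have h6 := h4.sub h5
    rw [Int.cast_zero, zero_mul, Real.cos_zero, mul_one, add_sub_cancel_right] at h6
    refine h6.congr_fun fun k => ?_
    push_cast
    rw [neg_mul, Real.cos_neg]
    split_ifs with hk
    · subst hk; simp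
    · ring

end

/-! ### Chebyshev series of smooth symbols -/

section

/-- The function `θ ↦ b δ v / u` in the variable `u = cos θ = exp (-τ v)`, extended by `0` to
`cos θ ≤ 0`. -/
def circleSymbol (b : ℝ → ℝ → ℝ) (τ δ θ : ℝ) : ℝ :=
  if 0 < Real.cos θ then b δ (-Real.log (Real.cos θ) / τ) / Real.cos θ else 0

lemma contDiff_circleSymbol {b : ℝ → ℝ → ℝ} (hb : ContDiff ℝ ∞ (Function.uncurry b)) {V : ℝ}
    (hV : ∀ δ v, V ≤ v → b δ v = 0) {τ : ℝ} (hτ : 0 < τ) :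
    ContDiff ℝ ∞ (Function.uncurry (circleSymbol b τ)) := by
  have hcos : Continuous fun p : ℝ × ℝ => Real.cos p.2 := Real.continuous_cos.comp continuous_snd
  rw [contDiff_iff_contDiffAt]
  rintro ⟨δ, θ⟩
  by_cases h : 0 < Real.cos θ
  · have hev : Function.uncurry (circleSymbol b τ) =ᶠ[𝓝 (δ, θ)]
        fun p => Function.uncurry b (p.1, -Real.log (Real.cos p.2) / τ) / Real.cos p.2 := by
      filter_upwards [hcos.continuousAt.eventually (lt_mem_nhds h)] with p hp
      simp only [Function.uncurry, circleSymbol, if_pos hp]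
    refine ContDiffAt.congr_of_eventuallyEq ?_ hev
    have hc : ContDiffAt ℝ ∞ (fun p : ℝ × ℝ => Real.cos p.2) (δ, θ) :=
      (Real.contDiff_cos.comp contDiff_snd).contDiffAt
    refine ContDiffAt.div ?_ hc h.ne'
    refine hb.contDiffAt.comp _ (contDiffAt_fst.prodMk ?_)
    exact ((hc.log h.ne').neg).div_const τ
  -- Near `cos θ ≤ 0` the function vanishes, as `cos θ < exp (-τ V)` means `v > V`.
  · have hlt : Real.cos θ < Real.exp (-τ * V) := (not_lt.1 h).trans_lt (Real.exp_pos _)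
    have hev : Function.uncurry (circleSymbol b τ) =ᶠ[𝓝 (δ, θ)] fun _ => 0 := by
      filter_upwards [hcos.continuousAt.eventually (gt_mem_nhds hlt)] with p hp
      simp only [Function.uncurry, circleSymbol]
      split_ifs with hpos
      · rw [hV, zero_div]
        rw [le_div_iff₀ hτ]
        have := (Real.log_lt_iff_lt_exp hpos).2 hp
        linarith
      · rfl
    exact contDiffAt_const.congr_of_eventuallyEq hev

/-- A smooth compactly supported symbol is `u` times a rapidly converging series of Chebyshev
polynomials in `u = exp (-τ v)`, uniformly in the parameter. -/
lemma exists_chebyshev_series {b : ℝ → ℝ → ℝ} (hb : ContDiff ℝ ∞ (Function.uncurry b)) {V : ℝ}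
    (hV : ∀ δ v, V ≤ v → b δ v = 0) {τ : ℝ} (hτ : 0 < τ) (E : ℝ) {S : ℕ} (hS : 2 ≤ S) :
    ∃ B : ℝ, 0 ≤ B ∧ ∀ δ ∈ Set.Icc 0 E, ∃ a : ℕ → ℝ, (∀ k : ℕ, |a k| ≤ B / (1 + k) ^ S) ∧
      ∀ v, 0 ≤ v → HasSum (fun k : ℕ => a k *
        (Real.exp (-τ * v) * (Polynomial.Chebyshev.T ℝ k).eval (Real.exp (-τ * v)))) (b δ v) := by
  obtain ⟨B, hB, h⟩ := exists_cos_series (contDiff_circleSymbol hb hV hτ)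
    (fun ε θ => by simp [circleSymbol]) (fun ε θ => by simp [circleSymbol]) E hS
  refine ⟨B, hB, fun δ hδ => ?_⟩
  obtain ⟨a, ha, hsum⟩ := h δ hδ
  refine ⟨a, ha, fun v hv => ?_⟩
  have hu0 : 0 < Real.exp (-τ * v) := Real.exp_pos _
  have hu1 : Real.exp (-τ * v) ≤ 1 := Real.exp_le_one_iff.2 (by nlinarith)
  have hcos : Real.cos (Real.arccos (Real.exp (-τ * v))) = Real.exp (-τ * v) :=
    Real.cos_arccos (by linarith) hu1
  have h1 := (hsum (Real.arccos (Real.exp (-τ * v)))).mul_left (Real.exp (-τ * v))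
  have h2 : Real.exp (-τ * v) * circleSymbol b τ δ (Real.arccos (Real.exp (-τ * v))) = b δ v := by
    rw [circleSymbol, hcos, if_pos hu0, Real.log_exp, mul_div_cancel₀ _ hu0.ne']
    congr 1
    field_simp
  rw [h2] at h1
  refine h1.congr_fun fun k => ?_
  have h3 := Polynomial.Chebyshev.T_real_cos (Real.arccos (Real.exp (-τ * v))) k
  rw [hcos] at h3
  rw [h3, Int.cast_natCast]
  ring

end

/-! ### Localization of kernels -/

section

variable {X : Type*} {φ : ℕ → X → ℝ} {ℓ : ℕ → ℝ} {α : ℝ}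

/-- The heat kernel bound with its constants fixed. -/
def HeatBound [MetricSpace X] (φ : ℕ → X → ℝ) (ℓ : ℕ → ℝ) (α C κ : ℝ) : Prop :=
  ∀ t : ℝ, 0 < t → t ≤ 1 → ∀ x y : X, Summable (heatTerm φ ℓ t x y) ∧
    |∑' j, heatTerm φ ℓ t x y j| ≤ C * t ^ (-α / 2) * Real.exp (-κ * dist x y ^ 2 / t)

lemma HeatBound.abs_heatTerm [MetricSpace X] {C κ : ℝ} (hH : HeatBound φ ℓ α C κ) {t : ℝ} (ht : 0 < t)
    (ht1 : t ≤ 1) (x y : X) : Summable (fun j => |heatTerm φ ℓ t x y j|) ∧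
    ∑' j, |heatTerm φ ℓ t x y j| ≤ C * t ^ (-α / 2) := by
  have hx := hH t ht ht1 x x
  have hy := hH t ht ht1 y y
  have hle : ∀ j, |heatTerm φ ℓ t x y j| ≤
      (heatTerm φ ℓ t x x j + heatTerm φ ℓ t y y j) / 2 := by
    intro j
    have h0 := Real.exp_pos (-(ℓ j) ^ 2 * t)
    simp only [heatTerm]
    rw [mul_assoc, abs_mul, abs_of_pos h0, mul_assoc, mul_assoc, ← mul_add, mul_div_assoc]
    gcongr
    rw [abs_le]
    constructor <;> nlinarith [sq_nonneg (φ j x + φ j y), sq_nonneg (φ j x - φ j y)]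
  have hs := (hx.1.add hy.1).div_const 2
  have hsum : Summable (fun j => |heatTerm φ ℓ t x y j|) :=
    Summable.of_nonneg_of_le (fun j => abs_nonneg _) hle hs
  refine ⟨hsum, (hsum.tsum_le_tsum hle hs).trans ?_⟩
  rw [tsum_div_const, hx.1.tsum_add hy.1]
  have ex := (le_abs_self _).trans hx.2
  have ey := (le_abs_self _).trans hy.2
  simp only [dist_self, ne_eq, OfNat.ofNat_ne_zero, not_false_eq_true, zero_pow, mul_zero,
    zero_div, Real.exp_zero, mul_one] at ex ey
  linarith

/-- The terms of the kernel `∑ j, u_j ^ m T_k(u_j) φ_j(x) φ_j(y)` with `u_j = exp (-ℓ_j ^ 2 t)`. -/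
def chebTerm (φ : ℕ → X → ℝ) (ℓ : ℕ → ℝ) (t : ℝ) (x y : X) (m k : ℕ) (j : ℕ) : ℝ :=
  Real.exp (-(ℓ j) ^ 2 * t) ^ m *
    (Polynomial.Chebyshev.T ℝ k).eval (Real.exp (-(ℓ j) ^ 2 * t)) * φ j x * φ j y

lemma exp_neg_sq_le_one {t : ℝ} (ht : 0 < t) (l : ℝ) : Real.exp (-l ^ 2 * t) ≤ 1 :=
  Real.exp_le_one_iff.2 (by nlinarith [mul_nonneg (sq_nonneg l) ht.le])

lemma abs_chebTerm_le {t : ℝ} (ht : 0 < t) (x y : X) {m : ℕ} (hm : 1 ≤ m) (k j : ℕ) :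
    |chebTerm φ ℓ t x y m k j| ≤ |heatTerm φ ℓ t x y j| := by
  have h0 := Real.exp_pos (-(ℓ j) ^ 2 * t)
  have h1 := exp_neg_sq_le_one ht (ℓ j)
  have hT : |(Polynomial.Chebyshev.T ℝ k).eval (Real.exp (-(ℓ j) ^ 2 * t))| ≤ 1 := by
    have h2 := Polynomial.Chebyshev.T_real_cos (Real.arccos (Real.exp (-(ℓ j) ^ 2 * t))) k
    rw [Real.cos_arccos (by linarith) h1] at h2
    rw [h2]
    exact Real.abs_cos_le_one _
  simp only [chebTerm, heatTerm, abs_mul, abs_pow, abs_of_pos h0]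
  gcongr
  calc _ ≤ Real.exp (-(ℓ j) ^ 2 * t) ^ m * 1 := by gcongr
    _ ≤ Real.exp (-(ℓ j) ^ 2 * t) := by
      rw [mul_one]
      exact pow_le_of_le_one h0.le h1 (by omega)

lemma chebTerm_zero_eq (t : ℝ) (x y : X) (m : ℕ) :
    chebTerm φ ℓ t x y m 0 = heatTerm φ ℓ (m * t) x y := by
  funext j
  simp only [chebTerm, heatTerm, Nat.cast_zero, Polynomial.Chebyshev.T_zero, Polynomial.eval_one,
    mul_one]
  rw [← Real.exp_nat_mul]
  congr 3
  ring

lemma chebTerm_one_eq (t : ℝ) (x y : X) (m : ℕ) :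
    chebTerm φ ℓ t x y m 1 = chebTerm φ ℓ t x y (m + 1) 0 := by
  funext j
  simp only [chebTerm, Nat.cast_zero, Nat.cast_one, Polynomial.Chebyshev.T_zero,
    Polynomial.Chebyshev.T_one, Polynomial.eval_one, Polynomial.eval_X]
  ring

lemma chebTerm_add_two (t : ℝ) (x y : X) (m k j : ℕ) :
    chebTerm φ ℓ t x y m (k + 2) j =
      2 * chebTerm φ ℓ t x y (m + 1) (k + 1) j - chebTerm φ ℓ t x y m k j := by
  simp only [chebTerm, Nat.cast_add, Nat.cast_one, Nat.cast_ofNat, Polynomial.Chebyshev.T_add_two,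
    Polynomial.eval_sub, Polynomial.eval_mul, Polynomial.eval_X, Polynomial.eval_ofNat]
  ring

/-- A Chebyshev polynomial of degree `k` in the heat semigroup is controlled, up to `3 ^ k`, by the
first heat kernels: the coefficients of `T_k` grow at most geometrically. -/
lemma abs_tsum_chebTerm_le [MetricSpace X] {C κ : ℝ} (hH : HeatBound φ ℓ α C κ) {t : ℝ} (ht : 0 < t)
    (ht1 : t ≤ 1) (x y : X) {n : ℕ} {W : ℝ}
    (hW : ∀ i : ℕ, 1 ≤ i → i ≤ n → |∑' j, heatTerm φ ℓ (i * t) x y j| ≤ W) (k : ℕ) :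
    ∀ m : ℕ, 1 ≤ m → m + k ≤ n → |∑' j, chebTerm φ ℓ t x y m k j| ≤ 3 ^ k * W := by
  have hs : ∀ m k : ℕ, 1 ≤ m → Summable (chebTerm φ ℓ t x y m k) := fun m k hm =>
    Summable.of_norm_bounded (hH.abs_heatTerm ht ht1 x y).1 fun j => abs_chebTerm_le ht x y hm k j
  induction k using Nat.strong_induction_on with
  | _ k ih =>
    intro m hm hmk
    match k, ih, hmk with
    | 0, _, hmk =>
      rw [chebTerm_zero_eq]; simpa using hW m hm (by omega)
    | 1, _, hmk =>
      rw [chebTerm_one_eq, chebTerm_zero_eq]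
      have h1 := hW (m + 1) (by omega) (by omega)
      have : 0 ≤ W := (abs_nonneg _).trans h1
      linarith
    | k + 2, ih, hmk =>
      have h1 := ih (k + 1) (by omega) (m + 1) (by omega) (by omega)
      have h2 := ih k (by omega) m hm (by omega)
      have hW0 : 0 ≤ W := (abs_nonneg _).trans (hW 1 le_rfl (by omega))
      simp only [chebTerm_add_two]
      rw [((hs (m + 1) (k + 1) (by omega)).mul_left 2).tsum_sub (hs m k hm), tsum_mul_left]
      refine (abs_sub _ _).trans ?_
      rw [abs_mul, abs_two]
      have : (0 : ℝ) ≤ 3 ^ k * W := by positivity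
      rw [pow_succ] at h1
      rw [pow_add]
      nlinarith

/-- Kernel localization. A multiplier `u_j ∑ k, a_k T_k(u_j)` with rapidly decreasing `a_k` has a
kernel that decays rapidly at distances beyond `√t`. -/
lemma HeatBound.exists_localized [MetricSpace X] [CompactSpace X] (hα : 0 < α) {C κ : ℝ} (hC : 0 < C) (hκ : 0 < κ)
    (hH : HeatBound φ ℓ α C κ) (S : ℕ) :
    ∃ C' : ℝ, 0 < C' ∧ ∀ t : ℝ, 0 < t → t ≤ 1 → ∀ B : ℝ, 0 ≤ B → ∀ a : ℕ → ℝ,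
      (∀ k : ℕ, |a k| ≤ B / (1 + k) ^ (S + 2)) → ∀ β : ℕ → ℝ,
      (∀ j, HasSum (fun k : ℕ => a k * (Real.exp (-(ℓ j) ^ 2 * t) *
        (Polynomial.Chebyshev.T ℝ k).eval (Real.exp (-(ℓ j) ^ 2 * t)))) (β j)) →
      ∀ x y : X, |∑' j, β j * φ j x * φ j y| ≤
        C' * B * t ^ (-α / 2) / (1 + dist x y / √t) ^ S := by
  -- `D ≥ diam X` keeps the times `i t`, `i ≤ n`, below `1`; `κ D ^ 2 ≥ 3` makes the Gaussian factor
  -- beat the growth `3 ^ n` of the Chebyshev coefficients.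
  set D : ℝ := 1 + Metric.diam (Set.univ : Set X) + 3 / κ with hD
  have hdiam : ∀ x y : X, dist x y ≤ Metric.diam (Set.univ : Set X) := fun x y =>
    Metric.dist_le_diam_of_mem isCompact_univ.isBounded trivial trivial
  have hd0 : 0 ≤ Metric.diam (Set.univ : Set X) := Metric.diam_nonneg
  have hκ3 : 0 < 3 / κ := by positivity
  have hD1 : 1 ≤ D := by linarith
  have hDκ : 3 ≤ κ * D ^ 2 := by
    have : 3 / κ ≤ D := by linarith
    have h2 : 3 ≤ κ * D := by rwa [div_le_iff₀' hκ] at this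
    nlinarith
  have hsq : Summable fun k : ℕ => 1 / ((1 : ℝ) + k) ^ 2 := by
    have := (summable_nat_add_iff 1).2 (Real.summable_one_div_nat_pow.2 (by norm_num : 1 < 2))
    refine this.congr fun k => ?_
    push_cast; rw [add_comm]
  set Z : ℝ := ∑' k : ℕ, 1 / ((1 : ℝ) + k) ^ 2 with hZ
  have hZ0 : 0 < Z := hsq.tsum_pos (fun k => by positivity) 0 (by norm_num)
  set G : ℝ := Real.exp 1 * S.factorial with hG
  have hG1 : 1 ≤ G := by
    have h1 : (1 : ℝ) ≤ S.factorial := by exact_mod_cast S.factorial_pos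
    have h2 : (1 : ℝ) ≤ Real.exp 1 := Real.one_le_exp (by norm_num)
    nlinarith
  refine ⟨C * G * Z * (1 + D) ^ S, by positivity, fun t ht ht1 B hB a ha β hβ x y => ?_⟩
  have hst : 0 < √t := Real.sqrt_pos.2 ht
  set R : ℝ := dist x y / √t with hR
  have hR0 : 0 ≤ R := by positivity
  -- The series in `k` is split at `n`, the distance in units of `D √t`.
  set n : ℕ := ⌊R / D⌋₊ with hn
  have hn1 : (n : ℝ) ≤ R / D := Nat.floor_le (by positivity)
  have hn2 : R / D < n + 1 := Nat.lt_floor_add_one _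
  have hT0 : 0 < C * t ^ (-α / 2) := by positivity
  obtain ⟨hs, hle⟩ := hH.abs_heatTerm ht ht1 x y
  have htriv : ∀ k, |∑' j, chebTerm φ ℓ t x y 1 k j| ≤ C * t ^ (-α / 2) := by
    intro k
    have hb : ∀ j, ‖chebTerm φ ℓ t x y 1 k j‖ ≤ |heatTerm φ ℓ t x y j| := fun j =>
      abs_chebTerm_le ht x y le_rfl k j
    exact (tsum_of_norm_bounded hs.hasSum hb).trans hle
  have hnear : ∀ k, k < n →
      |∑' j, chebTerm φ ℓ t x y 1 k j| ≤ C * t ^ (-α / 2) * (G / (1 + n) ^ S) := by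
    intro k hk
    have hn0 : (1 : ℝ) ≤ n := by exact_mod_cast (by omega : 1 ≤ n)
    have hRn : n * D ≤ R := by rwa [le_div_iff₀ (by linarith)] at hn1
    have hnt : n * t ≤ 1 := by
      have h1 : dist x y = R * √t := by rw [hR]; field_simp
      have h2 : n * D * √t ≤ dist x y := by rw [h1]; gcongr
      have h3 : √t ≤ 1 := Real.sqrt_le_one.2 ht1
      have h4 : n * D * √t ≤ D := h2.trans ((hdiam x y).trans (by linarith))
      have h5 : n * √t ≤ 1 := by
        have : D * (n * √t) ≤ D * 1 := by linarith
        exact le_of_mul_le_mul_left this (by linarith)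
      calc n * t = n * √t * √t := by rw [mul_assoc, Real.mul_self_sqrt ht.le]
        _ ≤ 1 * 1 := by gcongr
        _ = 1 := one_mul 1
    have hW : ∀ i : ℕ, 1 ≤ i → i ≤ n → |∑' j, heatTerm φ ℓ (i * t) x y j| ≤
        C * t ^ (-α / 2) * Real.exp (-3 * n) := by
      intro i hi hin
      have hi1 : (1 : ℝ) ≤ i := by exact_mod_cast hi
      have hin' : (i : ℝ) ≤ n := by exact_mod_cast hin
      have hit : 0 < i * t := by positivity
      have hit1 : i * t ≤ 1 := le_trans (by gcongr) hnt
      refine (hH (i * t) hit hit1 x y).2.trans ?_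
      have h1 : (i * t) ^ (-α / 2) ≤ t ^ (-α / 2) :=
        Real.rpow_le_rpow_of_nonpos ht (by nlinarith) (by linarith)
      have h2 : -κ * dist x y ^ 2 / (i * t) ≤ -3 * n := by
        rw [div_le_iff₀ hit]
        have h3 : dist x y ^ 2 = R ^ 2 * t := by
          rw [hR, div_pow, Real.sq_sqrt ht.le]; field_simp
        have h4 : (n * D) ^ 2 ≤ R ^ 2 := by gcongr
        have h5 : 3 * (n : ℝ) ^ 2 ≤ κ * R ^ 2 := by
          calc 3 * (n : ℝ) ^ 2 ≤ κ * D ^ 2 * n ^ 2 := by gcongr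
            _ = κ * (n * D) ^ 2 := by ring
            _ ≤ κ * R ^ 2 := by gcongr
        have h6 : 3 * (n * (i * t)) ≤ κ * R ^ 2 * t := by
          calc 3 * (n * (i * t)) ≤ 3 * (n * (n * t)) := by gcongr
            _ = 3 * (n : ℝ) ^ 2 * t := by ring
            _ ≤ κ * R ^ 2 * t := by gcongr
        rw [h3]; linarith
      gcongr
    have h1 := abs_tsum_chebTerm_le hH ht ht1 x y hW k 1 le_rfl (by omega)
    refine h1.trans ?_
    rw [mul_left_comm]
    gcongr
    have h2 : (3 : ℝ) ^ k ≤ Real.exp (2 * n) := by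
      have h3 : (3 : ℝ) ≤ Real.exp 2 := by
        have := Real.add_one_le_exp (2 : ℝ); linarith
      calc (3 : ℝ) ^ k ≤ 3 ^ n := pow_le_pow_right₀ (by norm_num) hk.le
        _ ≤ Real.exp 2 ^ n := by gcongr
        _ = Real.exp (2 * n) := by rw [← Real.exp_nat_mul, mul_comm]
    have h4 := Real.pow_div_factorial_le_exp (1 + n : ℝ) (by positivity) S
    have h5 : Real.exp (2 * n) * Real.exp (-3 * n) = Real.exp 1 * (Real.exp (1 + n))⁻¹ := by
      rw [← Real.exp_neg, ← Real.exp_add, ← Real.exp_add]; congr 1; ring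
    calc 3 ^ k * Real.exp (-3 * n) ≤ Real.exp (2 * n) * Real.exp (-3 * n) := by gcongr
      _ = Real.exp 1 * (Real.exp (1 + n))⁻¹ := h5
      _ ≤ Real.exp 1 * ((1 + n : ℝ) ^ S / S.factorial)⁻¹ := by gcongr
      _ = G / (1 + n) ^ S := by rw [inv_div, hG]; ring
  have hterm : ∀ k, |a k * ∑' j, chebTerm φ ℓ t x y 1 k j| ≤
      B * (C * t ^ (-α / 2)) * (G / (1 + n) ^ S) * (1 / (1 + k) ^ 2) := by
    intro k
    rw [abs_mul]
    have hk1 : (1 : ℝ) ≤ (1 + k) ^ S := one_le_pow₀ (by linarith [k.cast_nonneg (α := ℝ)])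
    have hk2 : (0 : ℝ) < (1 + k) ^ 2 := by positivity
    rcases lt_or_ge k n with hk | hk
    · have h1 : |a k| ≤ B * (1 / (1 + k) ^ 2) := by
        refine (ha k).trans ?_
        rw [mul_one_div, pow_add]
        gcongr
        nlinarith
      calc _ ≤ B * (1 / (1 + k) ^ 2) * (C * t ^ (-α / 2) * (G / (1 + n) ^ S)) := by
            gcongr; exact hnear k hk
        _ = _ := by ring
    · have h1 : |a k| ≤ B * (1 / (1 + n) ^ S * (1 / (1 + k) ^ 2)) := by
        refine (ha k).trans ?_
        rw [div_eq_mul_one_div, pow_add, ← one_div_mul_one_div]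
        have : (n : ℝ) ≤ k := by exact_mod_cast hk
        gcongr
      calc _ ≤ B * (1 / (1 + n) ^ S * (1 / (1 + k) ^ 2)) * (C * t ^ (-α / 2) * 1) := by
            gcongr; rw [mul_one]; exact htriv k
        _ ≤ B * (1 / (1 + n) ^ S * (1 / (1 + k) ^ 2)) * (C * t ^ (-α / 2) * G) := by gcongr
        _ = _ := by ring
  have hswap : ∑' j, β j * φ j x * φ j y = ∑' k, a k * ∑' j, chebTerm φ ℓ t x y 1 k j := by
    have hasum : Summable fun k => |a k| := by
      refine Summable.of_nonneg_of_le (fun k => abs_nonneg _) (fun k => ?_) (hsq.mul_left B)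
      refine (ha k).trans ?_
      rw [mul_one_div]
      gcongr
      · linarith [k.cast_nonneg (α := ℝ)]
      · omega
    have hprod : Summable (Function.uncurry fun j k => a k * chebTerm φ ℓ t x y 1 k j) := by
      refine Summable.of_norm_bounded (hs.mul_of_nonneg hasum (fun _ => abs_nonneg _)
        (fun _ => abs_nonneg _)) fun p => ?_
      simp only [Function.uncurry, Real.norm_eq_abs]
      rw [abs_mul, mul_comm]
      exact mul_le_mul_of_nonneg_right (abs_chebTerm_le ht x y le_rfl _ _) (abs_nonneg _)
    simp_rw [← tsum_mul_left]
    rw [hprod.tsum_comm]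
    refine tsum_congr fun j => ?_
    rw [mul_assoc, ← (hβ j).tsum_eq, ← tsum_mul_right]
    refine tsum_congr fun k => ?_
    simp only [chebTerm, pow_one]
    ring
  rw [hswap]
  have hfin : |∑' k, a k * ∑' j, chebTerm φ ℓ t x y 1 k j| ≤
      B * (C * t ^ (-α / 2)) * (G / (1 + n) ^ S) * Z := by
    rw [← Real.norm_eq_abs]
    exact tsum_of_norm_bounded (hsq.hasSum.mul_left _) hterm
  refine hfin.trans ?_
  have hRn : 1 + R ≤ (1 + D) * (1 + n) := by
    rw [div_lt_iff₀ (by linarith)] at hn2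
    nlinarith [n.cast_nonneg (α := ℝ)]
  have hpow : (1 + R) ^ S ≤ (1 + D) ^ S * (1 + n) ^ S := by
    rw [← mul_pow]; gcongr
  have : 1 / ((1 : ℝ) + n) ^ S ≤ (1 + D) ^ S / (1 + R) ^ S := by
    rw [div_le_div_iff₀ (by positivity) (by positivity)]; linarith
  calc _ = B * (C * t ^ (-α / 2)) * G * Z * (1 / (1 + n) ^ S) := by ring
    _ ≤ B * (C * t ^ (-α / 2)) * G * Z * ((1 + D) ^ S / (1 + R) ^ S) := by gcongr
    _ = _ := by ring

end

/-! ### Uniform bounds on kernel norms and the symbols used -/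

section

variable {X : Type*} {φ : ℕ → X → ℝ} {ℓ : ℕ → ℝ} {α : ℝ}

/-- Integration of a rapidly decaying function over dyadic balls. -/
lemma lintegral_localized_le [MetricSpace X] [MeasurableSpace X] [BorelSpace X] {S : ℕ}
    (hα : 0 < α) (hS : α < S) : ∃ c : ℝ, 0 < c ∧ ∀ M : ℝ, 0 < M → ∀ K : ℝ, 0 ≤ K → ∀ m : Measure X,
      (∀ x : X, ∀ ρ : ℝ, 0 < ρ →
        m (Metric.closedBall x ρ) ≤ ENNReal.ofReal (K * (ρ ^ α + M ^ (-α)))) →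
      ∀ x : X, ∫⁻ y, ENNReal.ofReal (1 / (1 + M * dist x y) ^ S) ∂m ≤
        ENNReal.ofReal (c * K * M ^ (-α)) := by
  have hsum : Summable fun k : ℕ => 2 ^ S / ((2 : ℝ) ^ k) ^ S * (((2 : ℝ) ^ k) ^ α + 1) := by
    have h1 : Summable fun k : ℕ => (((2 : ℝ) ^ (S : ℝ))⁻¹) ^ k :=
      summable_geometric_of_lt_one (by positivity) (inv_lt_one_of_one_lt₀
        (Real.one_lt_rpow (by norm_num) (hα.trans hS)))
    have h2 : Summable fun k : ℕ => ((2 : ℝ) ^ (α - S)) ^ k :=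
      summable_geometric_of_lt_one (by positivity)
        (Real.rpow_lt_one_of_one_lt_of_neg (by norm_num) (by linarith))
    refine ((h1.add h2).mul_left (2 ^ S)).congr fun k => ?_
    have e1 : ((2 : ℝ) ^ k) ^ α = ((2 : ℝ) ^ α) ^ k := by
      rw [← Real.rpow_natCast, ← Real.rpow_natCast, ← Real.rpow_mul (by norm_num),
        ← Real.rpow_mul (by norm_num), mul_comm]
    rw [Real.rpow_sub (by norm_num), Real.rpow_natCast, e1, ← pow_mul, mul_comm k S, pow_mul,
      div_pow, inv_pow]
    ring
  refine ⟨∑' k : ℕ, 2 ^ S / ((2 : ℝ) ^ k) ^ S * (((2 : ℝ) ^ k) ^ α + 1),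
    hsum.tsum_pos (fun k => by positivity) 0 (by positivity), fun M hM K hK m hm x => ?_⟩
  -- The term of the least `k` with `M dist(x, y) ≤ 2 ^ k` already dominates.
  have hpt : ∀ y, ENNReal.ofReal (1 / (1 + M * dist x y) ^ S) ≤
      ∑' k : ℕ, ENNReal.ofReal (2 ^ S / ((2 : ℝ) ^ k) ^ S) *
        (Metric.closedBall x (2 ^ k / M)).indicator 1 y := by
    intro y
    have hex : ∃ k : ℕ, M * dist x y ≤ 2 ^ k :=
      (pow_unbounded_of_one_lt (M * dist x y) one_lt_two).imp fun _ h => h.le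
    classical
    set k := Nat.find hex with hk
    have hk1 : M * dist x y ≤ 2 ^ k := Nat.find_spec hex
    have hd : 0 ≤ M * dist x y := by positivity
    refine le_trans ?_ (ENNReal.le_tsum k)
    have hmem : y ∈ Metric.closedBall x (2 ^ k / M) := by
      rw [Metric.mem_closedBall, dist_comm, le_div_iff₀ hM]; linarith
    rw [Set.indicator_of_mem hmem, Pi.one_apply, mul_one]
    apply ENNReal.ofReal_le_ofReal
    rw [← div_pow, ← one_div_pow]
    apply pow_le_pow_left₀ (by positivity)
    rcases Nat.eq_zero_or_pos k with h0 | hpos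
    · rw [h0, pow_zero, div_one, div_le_iff₀ (by positivity)]; linarith
    · have h2 : ¬ M * dist x y ≤ 2 ^ (k - 1) := Nat.find_min hex (by omega)
      have h3 : (2 : ℝ) ^ k = 2 * 2 ^ (k - 1) := by rw [← pow_succ']; congr 1; omega
      rw [h3, div_le_div_iff₀ (by positivity) (by positivity)]
      push Not at h2
      linarith
  calc _ ≤ ∫⁻ y, ∑' k : ℕ, ENNReal.ofReal (2 ^ S / ((2 : ℝ) ^ k) ^ S) *
        (Metric.closedBall x (2 ^ k / M)).indicator 1 y ∂m := lintegral_mono hpt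
    _ = ∑' k : ℕ, ENNReal.ofReal (2 ^ S / ((2 : ℝ) ^ k) ^ S) *
        m (Metric.closedBall x (2 ^ k / M)) := by
      have hmeas : ∀ k : ℕ, Measurable
          ((Metric.closedBall x (2 ^ k / M)).indicator (1 : X → ℝ≥0∞)) := fun k =>
        measurable_one.indicator Metric.isClosed_closedBall.measurableSet
      rw [lintegral_tsum fun k => ((hmeas k).const_mul _).aemeasurable]
      refine tsum_congr fun k => ?_
      rw [lintegral_const_mul _ (hmeas k),
        lintegral_indicator_one Metric.isClosed_closedBall.measurableSet]
    _ ≤ ∑' k : ℕ, ENNReal.ofReal (2 ^ S / ((2 : ℝ) ^ k) ^ S * (((2 : ℝ) ^ k) ^ α + 1) *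
          (K * M ^ (-α))) := by
      refine ENNReal.tsum_le_tsum fun k => ?_
      rw [mul_assoc, ENNReal.ofReal_mul (by positivity)]
      gcongr
      refine (hm x _ (by positivity)).trans_eq ?_
      congr 1
      rw [Real.div_rpow (by positivity) hM.le, Real.rpow_neg hM.le]
      ring
    _ = _ := by
      rw [← ENNReal.ofReal_tsum_of_nonneg (fun k => by positivity) (hsum.mul_right _),
        tsum_mul_right, mul_assoc]

/-- Kernels `∑ j, b(δ, (ℓ_j / M) ^ 2) φ_j(x) φ_j(y)` have uniformly bounded `L¹` norms, for every
measure that is `1 / M`-regular. -/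
lemma HeatBound.exists_kernel_bound [MetricSpace X] [CompactSpace X] [MeasurableSpace X]
    [BorelSpace X] (hα : 0 < α) {C κ : ℝ} (hC : 0 < C) (hκ : 0 < κ) (hH : HeatBound φ ℓ α C κ)
    {b : ℝ → ℝ → ℝ} (hb : ContDiff ℝ ∞ (Function.uncurry b)) {V : ℝ}
    (hV : ∀ δ v, V ≤ v → b δ v = 0) (E : ℝ) {M₀ : ℝ} (hM₀ : 0 < M₀) :
    ∃ c : ℝ, 0 < c ∧ ∀ δ ∈ Set.Icc 0 E, ∀ M : ℝ, M₀ ≤ M → ∀ K : ℝ, 0 ≤ K → ∀ m : Measure X,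
      (∀ x : X, ∀ ρ : ℝ, 0 < ρ →
        m (Metric.closedBall x ρ) ≤ ENNReal.ofReal (K * (ρ ^ α + M ^ (-α)))) →
      ∀ x : X, ∫⁻ y, ‖∑' j, b δ ((ℓ j / M) ^ 2) * φ j x * φ j y‖ₑ ∂m ≤ ENNReal.ofReal (c * K) := by
  obtain ⟨S, hS⟩ := exists_nat_gt α
  obtain ⟨c₁, hc₁, h₁⟩ := lintegral_localized_le (X := X) hα hS
  obtain ⟨c₂, hc₂, h₂⟩ := hH.exists_localized hα hC hκ S
  set τ : ℝ := min (M₀ ^ 2) 1 with hτ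
  have hτ0 : 0 < τ := lt_min (by positivity) one_pos
  have hτ1 : τ ≤ 1 := min_le_right _ _
  -- With `τ ≤ M₀ ^ 2` the time `t = τ / M ^ 2` is at most `1` for every `M ≥ M₀`.
  obtain ⟨B, hB, h₃⟩ := exists_chebyshev_series hb hV hτ0 E (S := S + 2) (by omega)
  refine ⟨c₂ * (B + 1) * τ ^ (-α / 2) * c₁, by positivity, fun δ hδ M hM K hK m hm x => ?_⟩
  have hM0 : 0 < M := hM₀.trans_le hM
  obtain ⟨a, ha, hser⟩ := h₃ δ hδ
  set t : ℝ := τ / M ^ 2 with ht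
  have ht0 : 0 < t := by positivity
  have ht1 : t ≤ 1 := by
    rw [div_le_one (by positivity)]
    exact (min_le_left _ _).trans (by gcongr)
  have hexp : ∀ j, -(ℓ j) ^ 2 * t = -τ * (ℓ j / M) ^ 2 := fun j => by
    rw [ht]; field_simp
  have htp : t ^ (-α / 2) = τ ^ (-α / 2) * M ^ α := by
    rw [ht, Real.div_rpow hτ0.le (by positivity), ← Real.rpow_natCast M 2, ← Real.rpow_mul hM0.le,
      div_eq_mul_inv, ← Real.rpow_neg hM0.le]
    congr 2; push_cast; ring
  have hpt : ∀ y, ‖∑' j, b δ ((ℓ j / M) ^ 2) * φ j x * φ j y‖ₑ ≤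
      ENNReal.ofReal (c₂ * (B + 1) * τ ^ (-α / 2) * M ^ α) *
        ENNReal.ofReal (1 / (1 + M * dist x y) ^ S) := by
    intro y
    rw [← ENNReal.ofReal_mul (by positivity), ← ofReal_norm, Real.norm_eq_abs]
    apply ENNReal.ofReal_le_ofReal
    refine (h₂ t ht0 ht1 B hB a ha (fun j => b δ ((ℓ j / M) ^ 2)) (fun j => ?_) x y).trans ?_
    · rw [hexp]; exact hser _ (by positivity)
    · rw [htp, mul_one_div, ← mul_assoc]
      have hst : √t ≤ 1 / M := by
        rw [ht, Real.sqrt_div' _ (by positivity), Real.sqrt_sq hM0.le]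
        gcongr
        exact Real.sqrt_le_one.2 hτ1
      have hst0 : 0 < √t := Real.sqrt_pos.2 ht0
      have : M * dist x y ≤ dist x y / √t := by
        rw [le_div_iff₀ hst0]
        calc M * dist x y * √t ≤ M * dist x y * (1 / M) := by gcongr
          _ = dist x y := by field_simp
      gcongr
      linarith
  calc _ ≤ ∫⁻ y, ENNReal.ofReal (c₂ * (B + 1) * τ ^ (-α / 2) * M ^ α) *
        ENNReal.ofReal (1 / (1 + M * dist x y) ^ S) ∂m := lintegral_mono hpt
    _ = ENNReal.ofReal (c₂ * (B + 1) * τ ^ (-α / 2) * M ^ α) *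
        ∫⁻ y, ENNReal.ofReal (1 / (1 + M * dist x y) ^ S) ∂m := by
      rw [lintegral_const_mul']
      exact ENNReal.ofReal_ne_top
    _ ≤ ENNReal.ofReal (c₂ * (B + 1) * τ ^ (-α / 2) * M ^ α) *
        ENNReal.ofReal (c₁ * K * M ^ (-α)) := by gcongr; exact h₁ M hM0 K hK m hm x
    _ = _ := by
      rw [← ENNReal.ofReal_mul (by positivity)]
      congr 1
      rw [Real.rpow_neg hM0.le]
      have : M ^ α ≠ 0 := by positivity
      field_simp

lemma contDiff_filter_sqrt {h : ℝ → ℝ} (hh : IsFilter h) :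
    ContDiff ℝ ∞ (Function.uncurry fun (_ : ℝ) (v : ℝ) => h √v) := by
  suffices H : ContDiff ℝ ∞ (fun v : ℝ => h √v) from H.comp contDiff_snd
  rw [contDiff_iff_contDiffAt]
  intro v
  rcases lt_or_ge v (1 / 4) with hv | hv
  · have hev : (fun v : ℝ => h √v) =ᶠ[𝓝 v] fun _ => 1 := by
      filter_upwards [gt_mem_nhds hv] with w hw
      apply hh.eq_one
      rw [abs_of_nonneg (Real.sqrt_nonneg w)]
      exact Real.sqrt_le_iff.2 ⟨by norm_num, by linarith⟩
    exact contDiffAt_const.congr_of_eventuallyEq hev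
  · exact hh.smooth.contDiffAt.comp v (Real.contDiffAt_sqrt (by linarith))

/-- The symbol `(h(s / 2) - h(s)) (δ ^ 2 + s) ^ q` with `s = √v`, supported in `1 / 2 ≤ s ≤ 2`.
The parameter enters through `δ ^ 2` so that the symbol is smooth in both variables everywhere. -/
def bandSymbol (h : ℝ → ℝ) (q δ v : ℝ) : ℝ := (h (√v / 2) - h √v) * (δ ^ 2 + √v) ^ q

lemma contDiff_bandSymbol {h : ℝ → ℝ} (hh : IsFilter h) (q : ℝ) :
    ContDiff ℝ ∞ (Function.uncurry (bandSymbol h q)) := by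
  rw [contDiff_iff_contDiffAt]
  rintro ⟨δ, v⟩
  rcases lt_or_ge v (1 / 4) with hv | hv
  · have hev : Function.uncurry (bandSymbol h q) =ᶠ[𝓝 (δ, v)] fun _ => 0 := by
      filter_upwards [continuousAt_snd.eventually (gt_mem_nhds hv)] with p hp
      have h0 := Real.sqrt_nonneg p.2
      have h1 : √p.2 ≤ 1 / 2 := Real.sqrt_le_iff.2 ⟨by norm_num, by linarith⟩
      simp only [Function.uncurry, bandSymbol]
      rw [hh.eq_one (√p.2) (by rwa [abs_of_nonneg h0]),
        hh.eq_one (√p.2 / 2) (by rw [abs_of_nonneg (by positivity)]; linarith), sub_self, zero_mul]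
    exact contDiffAt_const.congr_of_eventuallyEq hev
  · have hv0 : 0 < v := by linarith
    have hs : ContDiffAt ℝ ∞ (fun p : ℝ × ℝ => √p.2) (δ, v) :=
      contDiffAt_snd.sqrt hv0.ne'
    have hpos : 0 < δ ^ 2 + √v := by positivity
    refine ContDiffAt.mul (ContDiffAt.sub ?_ ?_) ?_
    · exact hh.smooth.contDiffAt.comp _ (hs.div_const 2)
    · exact hh.smooth.contDiffAt.comp _ hs
    · exact ((contDiffAt_fst.pow 2).add hs).rpow_const_of_ne hpos.ne'

lemma bandSymbol_eq_zero {h : ℝ → ℝ} (hh : IsFilter h) (q δ v : ℝ) (hv : 4 ≤ v) :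
    bandSymbol h q δ v = 0 := by
  have h1 : 2 ≤ √v := Real.le_sqrt_of_sq_le (by linarith)
  rw [bandSymbol, hh.eq_zero (√v) (by rw [abs_of_nonneg (by positivity)]; linarith),
    hh.eq_zero (√v / 2) (by rw [abs_of_nonneg (by positivity)]; linarith), sub_self, zero_mul]

end

/-! ### Frequency growth and the support of the measure -/

section

variable {X : Type*} [MetricSpace X] [CompactSpace X] [MeasurableSpace X] [BorelSpace X]
  {μ : Measure X} [IsProbabilityMeasure μ] {φ : ℕ → X → ℝ} {ℓ : ℕ → ℝ} {α : ℝ}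

lemma integrable_of_continuous {F : Type*} [NormedAddCommGroup F] {m : Measure X}
    [IsFiniteMeasure m] {u : X → F} (hu : Continuous u) : Integrable u m :=
  hu.integrable_of_hasCompactSupport (HasCompactSupport.of_compactSpace u)

omit [CompactSpace X] [BorelSpace X] [IsProbabilityMeasure μ] in
lemma IsDiffusionSystem.ell_nonneg (hsys : IsDiffusionSystem μ φ ℓ) (j : ℕ) : 0 ≤ ℓ j :=
  hsys.ell_zero ▸ hsys.ell_mono (Nat.zero_le j)

omit [CompactSpace X] [BorelSpace X] [IsProbabilityMeasure μ] in
lemma IsDiffusionSystem.integral_phi (hsys : IsDiffusionSystem μ φ ℓ) (j : ℕ) :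
    ∫ x, φ j x ∂μ = if j = 0 then 1 else 0 := by
  have := hsys.orthonormal j 0
  simpa [hsys.phi_zero] using this

omit [CompactSpace X] [BorelSpace X] [IsProbabilityMeasure μ] in
/-- `∑ φ_j(x) ^ 2` over the frequencies `ℓ_j ≤ M` is `O(M ^ α)`, uniformly in `x`. -/
lemma HeatBound.exists_sum_sq_le (hsys : IsDiffusionSystem μ φ ℓ) {C κ : ℝ} (hC : 0 < C)
    (hH : HeatBound φ ℓ α C κ) {M₀ : ℝ} (hM₀ : 0 < M₀) :
    ∃ c : ℝ, 0 < c ∧ ∀ M : ℝ, M₀ ≤ M → ∀ s : Finset ℕ, (∀ j ∈ s, ℓ j ≤ M) →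
      ∀ x, ∑ j ∈ s, φ j x ^ 2 ≤ c * M ^ α := by
  set τ : ℝ := min (M₀ ^ 2) 1 with hτ
  have hτ0 : 0 < τ := lt_min (by positivity) one_pos
  refine ⟨Real.exp τ * C * τ ^ (-α / 2), by positivity, fun M hM s hs x => ?_⟩
  have hM0 : 0 < M := hM₀.trans_le hM
  set t : ℝ := τ / M ^ 2 with ht
  have ht0 : 0 < t := by positivity
  have ht1 : t ≤ 1 := by
    rw [div_le_one (by positivity)]
    exact (min_le_left _ _).trans (by gcongr)
  have htp : t ^ (-α / 2) = τ ^ (-α / 2) * M ^ α := by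
    rw [ht, Real.div_rpow hτ0.le (by positivity), ← Real.rpow_natCast M 2, ← Real.rpow_mul hM0.le,
      div_eq_mul_inv, ← Real.rpow_neg hM0.le]
    congr 2; push_cast; ring
  obtain ⟨hsum, hle⟩ := hH.abs_heatTerm ht0 ht1 x x
  have hterm : ∀ j ∈ s, φ j x ^ 2 ≤ Real.exp τ * |heatTerm φ ℓ t x x j| := by
    intro j hj
    have h1 : ℓ j ^ 2 * t ≤ τ := by
      have : ℓ j ^ 2 ≤ M ^ 2 := pow_le_pow_left₀ (hsys.ell_nonneg j) (hs j hj) 2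
      calc ℓ j ^ 2 * t ≤ M ^ 2 * t := by gcongr
        _ = τ := by rw [ht]; field_simp
    have h2 : 1 ≤ Real.exp τ * Real.exp (-ℓ j ^ 2 * t) := by
      rw [← Real.exp_add]; exact Real.one_le_exp (by linarith)
    have h3 : |heatTerm φ ℓ t x x j| = Real.exp (-ℓ j ^ 2 * t) * φ j x ^ 2 := by
      rw [heatTerm, mul_assoc, ← sq, abs_of_nonneg (by positivity)]
    rw [h3, ← mul_assoc]
    exact le_mul_of_one_le_left (sq_nonneg _) h2
  calc ∑ j ∈ s, φ j x ^ 2 ≤ ∑ j ∈ s, Real.exp τ * |heatTerm φ ℓ t x x j| :=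
        Finset.sum_le_sum hterm
    _ = Real.exp τ * ∑ j ∈ s, |heatTerm φ ℓ t x x j| := by rw [Finset.mul_sum]
    _ ≤ Real.exp τ * (C * t ^ (-α / 2)) := by
      gcongr
      exact (hsum.sum_le_tsum s fun _ _ => abs_nonneg _).trans hle
    _ = _ := by rw [htp]; ring

lemma HeatBound.integral_heatKernel (hsys : IsDiffusionSystem μ φ ℓ) {C κ : ℝ}
    (hH : HeatBound φ ℓ α C κ) {t : ℝ} (ht : 0 < t) (ht1 : t ≤ 1) (x : X) :
    ∫ y, ∑' j, heatTerm φ ℓ t x y j ∂μ = 1 := by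
  have hcont : ∀ j, Continuous fun y => heatTerm φ ℓ t x y j := fun j =>
    continuous_const.mul (hsys.continuous j)
  have hi : ∀ j, Integrable (fun y => heatTerm φ ℓ t x y j) μ := fun j =>
    integrable_of_continuous (hcont j)
  have hs : Summable fun j => ∫ y, ‖heatTerm φ ℓ t x y j‖ ∂μ := by
    refine summable_of_sum_le (c := C * t ^ (-α / 2))
      (fun j => integral_nonneg fun y => norm_nonneg _) fun s => ?_
    rw [← integral_finsetSum _ fun j _ => (hi j).norm]
    have hb : ∀ y, ∑ j ∈ s, ‖heatTerm φ ℓ t x y j‖ ≤ C * t ^ (-α / 2) := fun y => by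
      obtain ⟨h1, h2⟩ := hH.abs_heatTerm ht ht1 x y
      exact (h1.sum_le_tsum s fun _ _ => abs_nonneg _).trans h2
    calc _ ≤ ∫ _, C * t ^ (-α / 2) ∂μ :=
          integral_mono (integrable_finsetSum _ fun j _ => (hi j).norm) (integrable_const _) hb
      _ = _ := by simp
  rw [← integral_tsum_of_summable_integral_norm hi hs]
  simp only [heatTerm, integral_const_mul, hsys.integral_phi, mul_ite, mul_one, mul_zero]
  rw [tsum_ite_eq]
  simp [hsys.ell_zero, hsys.phi_zero]

/-- The measure charges every nonempty open set: the heat kernel at a point outside the support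
would tend to `0` uniformly on the support, but its integral is `1`. -/
lemma HeatBound.isOpenPosMeasure (hsys : IsDiffusionSystem μ φ ℓ) {C κ : ℝ} (hκ : 0 < κ)
    (hH : HeatBound φ ℓ α C κ) : μ.IsOpenPosMeasure := by
  refine ⟨fun U hU hne hμU => ?_⟩
  obtain ⟨x, hx⟩ := hne
  obtain ⟨ε, hε, hball⟩ := Metric.isOpen_iff.1 hU x hx
  have hae : ∀ᵐ y ∂μ, ε ≤ dist x y := by
    have : ∀ᵐ y ∂μ, y ∉ U := measure_eq_zero_iff_ae_notMem.1 hμU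
    filter_upwards [this] with y hy
    by_contra hlt
    exact hy (hball (by rw [Metric.mem_ball, dist_comm]; exact not_le.1 hlt))
  have hkey : ∀ t : ℝ, 0 < t → t ≤ 1 → 1 ≤ |C| * t ^ (-α / 2) * Real.exp (-κ * ε ^ 2 / t) := by
    intro t ht ht1
    have h1 := hH.integral_heatKernel hsys ht ht1 x
    have h2 : ‖∫ y, ∑' j, heatTerm φ ℓ t x y j ∂μ‖ ≤
        |C| * t ^ (-α / 2) * Real.exp (-κ * ε ^ 2 / t) * μ.real Set.univ := by
      refine norm_integral_le_of_norm_le_const ?_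
      filter_upwards [hae] with y hy
      refine (hH t ht ht1 x y).2.trans ?_
      have h3 : Real.exp (-κ * dist x y ^ 2 / t) ≤ Real.exp (-κ * ε ^ 2 / t) := by
        apply Real.exp_le_exp.2
        have : ε ^ 2 ≤ dist x y ^ 2 := by gcongr
        gcongr ?_ / t
        nlinarith
      have h4 := le_abs_self C
      gcongr
    rw [h1] at h2
    simpa using h2
  have hlim : Tendsto (fun s : ℝ => |C| * (s ^ (α / 2) * Real.exp (-(κ * ε ^ 2) * s))) atTop
      (𝓝 0) := by
    have := (tendsto_rpow_mul_exp_neg_mul_atTop_nhds_zero (α / 2) (κ * ε ^ 2)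
      (by positivity)).const_mul |C|
    simpa using this
  obtain ⟨s, hs, hs1⟩ := ((hlim.eventually (gt_mem_nhds one_pos)).and (eventually_ge_atTop 1)).exists
  have hs0 : 0 < s := by linarith
  have h5 := hkey (1 / s) (by positivity) (by rw [div_le_one hs0]; exact hs1)
  have h6 : (1 / s) ^ (-α / 2) = s ^ (α / 2) := by
    rw [one_div, Real.inv_rpow hs0.le, ← Real.rpow_neg hs0.le]; congr 1; ring
  have h7 : -κ * ε ^ 2 / (1 / s) = -(κ * ε ^ 2) * s := by field_simp
  rw [h6, h7, mul_assoc] at h5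
  linarith

omit [CompactSpace X] [BorelSpace X] [IsProbabilityMeasure μ] in
/-- For a measure of full support, the `L^∞` norm of a continuous function is its sup norm. -/
lemma eLpNorm_top_le_iff [μ.IsOpenPosMeasure] {f : X → ℂ} (hf : Continuous f) {D : ℝ}
    (hD : 0 ≤ D) : eLpNorm f ∞ μ ≤ ENNReal.ofReal D ↔ ∀ x, ‖f x‖ ≤ D := by
  rw [eLpNorm_exponent_top]
  constructor
  · intro h
    have hae : ∀ᵐ x ∂μ, ‖f x‖ ≤ D := by
      filter_upwards [enorm_ae_le_eLpNormEssSup f μ] with x hx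
      have := hx.trans h
      rwa [← ofReal_norm, ENNReal.ofReal_le_ofReal_iff hD] at this
    have hopen : IsOpen {x | D < ‖f x‖} := isOpen_lt continuous_const hf.norm
    have hz : μ {x | D < ‖f x‖} = 0 := by
      have := ae_iff.1 hae
      simpa only [not_le] using this
    have he := hopen.measure_eq_zero_iff μ |>.1 hz
    intro x
    by_contra hx
    exact Set.notMem_empty x (he ▸ (not_le.1 hx : x ∈ {x | D < ‖f x‖}))
  · intro h
    exact eLpNormEssSup_le_of_ae_bound (ae_of_all _ h)

omit [BorelSpace X] [IsProbabilityMeasure μ] in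
lemma exists_eLpNorm_top_eq [μ.IsOpenPosMeasure] {f : X → ℂ} (hf : Continuous f) :
    ∃ D : ℝ, 0 ≤ D ∧ eLpNorm f ∞ μ = ENNReal.ofReal D ∧ ∀ x, ‖f x‖ ≤ D := by
  obtain ⟨M, hM⟩ := (isCompact_range hf).isBounded.exists_norm_le
  have h1 : eLpNorm f ∞ μ ≤ ENNReal.ofReal |M| :=
    (eLpNorm_top_le_iff hf (abs_nonneg M)).2 fun x => (hM _ ⟨x, rfl⟩).trans (le_abs_self M)
  have h2 : eLpNorm f ∞ μ = ENNReal.ofReal (eLpNorm f ∞ μ).toReal :=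
    (ENNReal.ofReal_toReal (ne_top_of_le_ne_top ENNReal.ofReal_ne_top h1)).symm
  exact ⟨_, ENNReal.toReal_nonneg, h2,
    (eLpNorm_top_le_iff hf ENNReal.toReal_nonneg).1 h2.le⟩

end

/-! ### Coefficients, diffusion polynomials and multiplier operators -/

section

/-- The indices of the frequencies `ℓ_j ≤ L`, a finite set for a diffusion system. -/
def lowFreq (ℓ : ℕ → ℝ) (L : ℝ) : Finset ℕ :=
  open Classical in if h : {j | ℓ j ≤ L}.Finite then h.toFinset else ∅

/-- The multiplier operator `f ↦ ∑ j ∈ s, β_j ⟨f, φ_j⟩ φ_j`. -/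
def multOp {X : Type*} [MeasurableSpace X] (μ : Measure X) (φ : ℕ → X → ℝ) (s : Finset ℕ)
    (β : ℕ → ℝ) (f : X → ℂ) (x : X) : ℂ :=
  ∑ j ∈ s, (β j : ℂ) * coeff μ φ f j * (φ j x : ℂ)

variable {X : Type*} [MetricSpace X] [CompactSpace X] [MeasurableSpace X] [BorelSpace X]
  {μ : Measure X} [IsProbabilityMeasure μ] {φ : ℕ → X → ℝ} {ℓ : ℕ → ℝ} {α : ℝ}

omit [CompactSpace X] [BorelSpace X] [IsProbabilityMeasure μ] in
lemma IsDiffusionSystem.mem_lowFreq (hsys : IsDiffusionSystem μ φ ℓ) {L : ℝ} {j : ℕ} :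
    j ∈ lowFreq ℓ L ↔ ℓ j ≤ L := by
  have hfin : {j | ℓ j ≤ L}.Finite := by
    obtain ⟨n, hn⟩ := (hsys.ell_tendsto.eventually_gt_atTop L).exists
    refine (Set.finite_lt_nat n).subset fun j hj => ?_
    by_contra hlt
    exact absurd (hn.trans_le (hsys.ell_mono (not_lt.1 hlt))) (not_lt.2 hj)
  rw [lowFreq, dif_pos hfin, Set.Finite.mem_toFinset, Set.mem_ofPred_eq]

omit [CompactSpace X] [BorelSpace X] [IsProbabilityMeasure μ] in
lemma IsDiffusionSystem.continuous_ofReal (hsys : IsDiffusionSystem μ φ ℓ) (j : ℕ) :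
    Continuous fun x => (φ j x : ℂ) :=
  Complex.continuous_ofReal.comp (hsys.continuous j)

section coeff

lemma coeff_sub (hsys : IsDiffusionSystem μ φ ℓ) {f g : X → ℂ} (hf : Continuous f)
    (hg : Continuous g) (k : ℕ) :
    coeff μ φ (fun x => f x - g x) k = coeff μ φ f k - coeff μ φ g k := by
  have hk := hsys.continuous_ofReal k
  simp only [coeff, sub_mul]
  exact integral_sub (integrable_of_continuous (hf.mul hk)) (integrable_of_continuous (hg.mul hk))

/-- The functions `φ_j` are bounded by `1` in `L¹`, hence so are the coefficients by `‖f‖_∞`. -/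
lemma norm_coeff_le (hsys : IsDiffusionSystem μ φ ℓ) {f : X → ℂ} {D : ℝ}
    (hD : ∀ x, ‖f x‖ ≤ D) (k : ℕ) : ‖coeff μ φ f k‖ ≤ D := by
  have hD0 : 0 ≤ D := by
    obtain ⟨x⟩ : Nonempty X := nonempty_of_isProbabilityMeasure μ
    exact (norm_nonneg _).trans (hD x)
  have hsq : Integrable (fun x => φ k x * φ k x) μ :=
    integrable_of_continuous ((hsys.continuous k).mul (hsys.continuous k))
  have hi : Integrable (fun x => D * ((1 + φ k x * φ k x) / 2)) μ :=
    (((integrable_const 1).add hsq).div_const 2).const_mul D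
  have h1 : ∫ x, D * ((1 + φ k x * φ k x) / 2) ∂μ = D := by
    rw [integral_const_mul, integral_div, integral_add (integrable_const 1) hsq,
      hsys.orthonormal]
    simp
  rw [← h1]
  refine norm_integral_le_of_norm_le hi (ae_of_all _ fun x => ?_)
  rw [norm_mul, Complex.norm_real, Real.norm_eq_abs]
  have h2 : |φ k x| ≤ (1 + φ k x * φ k x) / 2 := by
    rw [abs_le]; constructor <;> nlinarith [sq_nonneg (φ k x - 1), sq_nonneg (φ k x + 1)]
  exact mul_le_mul (hD x) h2 (abs_nonneg _) hD0

lemma coeff_sum (hsys : IsDiffusionSystem μ φ ℓ) (s : Finset ℕ) (c : ℕ → ℂ) (k : ℕ) :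
    coeff μ φ (fun x => ∑ j ∈ s, c j * (φ j x : ℂ)) k = if k ∈ s then c k else 0 := by
  simp only [coeff, Finset.sum_mul]
  rw [integral_finsetSum]
  · have h1 : ∀ j, ∫ x, c j * (φ j x : ℂ) * (φ k x : ℂ) ∂μ = if k = j then c j else 0 := by
      intro j
      have h2 : ∀ x, c j * (φ j x : ℂ) * (φ k x : ℂ) = c j * ((φ j x * φ k x : ℝ) : ℂ) := by
        intro x; push_cast; ring
      simp only [h2]
      rw [integral_const_mul, integral_complex_ofReal, hsys.orthonormal]
      by_cases hjk : j = k
      · simp [hjk]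
      · simp [hjk, Ne.symm hjk]
    simp only [h1]
    rw [Finset.sum_ite_eq]
  · intro j _
    exact integrable_of_continuous
      ((continuous_const.mul (hsys.continuous_ofReal j)).mul (hsys.continuous_ofReal k))

end coeff

omit [MetricSpace X] [CompactSpace X] [MeasurableSpace X] [BorelSpace X]
  [IsProbabilityMeasure μ] in
lemma sum_mem_diffPoly {s : Finset ℕ} {L : ℝ} (hs : ∀ j ∈ s, ℓ j ≤ L) (c : ℕ → ℂ) :
    (fun x => ∑ j ∈ s, c j * (φ j x : ℂ)) ∈ diffPoly φ ℓ L := by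
  have : (fun x => ∑ j ∈ s, c j * (φ j x : ℂ)) = ∑ j ∈ s, c j • fun x => (φ j x : ℂ) := by
    ext x; simp
  rw [this]
  exact Submodule.sum_mem _ fun j hj =>
    Submodule.smul_mem _ _ (Submodule.subset_span ⟨j, hs j hj, rfl⟩)

omit [CompactSpace X] [BorelSpace X] [IsProbabilityMeasure μ] in
lemma exists_eq_sum_of_mem_diffPoly (hsys : IsDiffusionSystem μ φ ℓ) {L : ℝ} {P : X → ℂ}
    (hP : P ∈ diffPoly φ ℓ L) :
    ∃ c : ℕ → ℂ, P = fun x => ∑ j ∈ lowFreq ℓ L, c j * (φ j x : ℂ) := by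
  induction hP using Submodule.span_induction with
  | mem p hp =>
    obtain ⟨i, hi, rfl⟩ := hp
    refine ⟨fun j => if i = j then 1 else 0, ?_⟩
    ext x
    simp [hsys.mem_lowFreq, hi]
  | zero => exact ⟨0, by ext x; simp⟩
  | add p q _ _ hp hq =>
    obtain ⟨c, rfl⟩ := hp
    obtain ⟨d, rfl⟩ := hq
    exact ⟨c + d, by ext x; simp [add_mul, Finset.sum_add_distrib]⟩
  | smul a p _ hp =>
    obtain ⟨c, rfl⟩ := hp
    exact ⟨a • c, by ext x; simp [Finset.mul_sum, mul_assoc]⟩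

lemma eq_sum_coeff_of_mem_diffPoly (hsys : IsDiffusionSystem μ φ ℓ) {L : ℝ} {P : X → ℂ}
    (hP : P ∈ diffPoly φ ℓ L) :
    P = fun x => ∑ j ∈ lowFreq ℓ L, coeff μ φ P j * (φ j x : ℂ) := by
  obtain ⟨c, hc⟩ := exists_eq_sum_of_mem_diffPoly hsys hP
  have : ∀ j ∈ lowFreq ℓ L, coeff μ φ P j = c j := fun j hj => by
    rw [hc, coeff_sum hsys, if_pos hj]
  ext x
  rw [Finset.sum_congr rfl fun j hj => by rw [this j hj]]
  exact congrFun hc x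

lemma coeff_eq_zero_of_mem_diffPoly (hsys : IsDiffusionSystem μ φ ℓ) {L : ℝ} {P : X → ℂ}
    (hP : P ∈ diffPoly φ ℓ L) {k : ℕ} (hk : L < ℓ k) : coeff μ φ P k = 0 := by
  obtain ⟨c, rfl⟩ := exists_eq_sum_of_mem_diffPoly hsys hP
  rw [coeff_sum hsys, if_neg]
  rw [hsys.mem_lowFreq]; exact not_le.2 hk

omit [CompactSpace X] [BorelSpace X] [IsProbabilityMeasure μ] in
lemma continuous_of_mem_diffPoly (hsys : IsDiffusionSystem μ φ ℓ) {L : ℝ} {P : X → ℂ}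
    (hP : P ∈ diffPoly φ ℓ L) : Continuous P := by
  obtain ⟨c, rfl⟩ := exists_eq_sum_of_mem_diffPoly hsys hP
  exact continuous_finsetSum _ fun j _ => continuous_const.mul (hsys.continuous_ofReal j)

omit [CompactSpace X] [BorelSpace X] [IsProbabilityMeasure μ] in
lemma mem_XInf_of_mem_diffPoly (hsys : IsDiffusionSystem μ φ ℓ) {L : ℝ} {P : X → ℂ}
    (hP : P ∈ diffPoly φ ℓ L) : P ∈ XInf μ φ ℓ :=
  ⟨continuous_of_mem_diffPoly hsys hP, fun ε _ => ⟨L, P, hP, by simp only [sub_self, eLpNorm_zero', zero_le]⟩⟩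

section multOp

omit [MetricSpace X] [CompactSpace X] [BorelSpace X] [IsProbabilityMeasure μ] in
lemma multOp_mem_diffPoly {s : Finset ℕ} {L : ℝ} (hs : ∀ j ∈ s, ℓ j ≤ L) (β : ℕ → ℝ)
    (f : X → ℂ) : multOp μ φ s β f ∈ diffPoly φ ℓ L :=
  sum_mem_diffPoly hs _

omit [MetricSpace X] [CompactSpace X] [BorelSpace X] [IsProbabilityMeasure μ] in
lemma multOp_of_subset {s t : Finset ℕ} (hst : s ⊆ t) {β : ℕ → ℝ}
    (hβ : ∀ j ∈ t, j ∉ s → β j = 0) (f : X → ℂ) : multOp μ φ t β f = multOp μ φ s β f := by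
  ext x
  refine (Finset.sum_subset hst fun j hj hjs => ?_).symm
  rw [hβ j hj hjs]; simp

lemma multOp_sub (hsys : IsDiffusionSystem μ φ ℓ) (s : Finset ℕ) (β : ℕ → ℝ) {f g : X → ℂ}
    (hf : Continuous f) (hg : Continuous g) (x : X) :
    multOp μ φ s β (fun x => f x - g x) x = multOp μ φ s β f x - multOp μ φ s β g x := by
  simp only [multOp]
  rw [← Finset.sum_sub_distrib]
  refine Finset.sum_congr rfl fun j _ => ?_
  rw [coeff_sub hsys hf hg]; ring

omit [MetricSpace X] [CompactSpace X] [BorelSpace X] [IsProbabilityMeasure μ] in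
lemma multOp_sub_symbol (s : Finset ℕ) (β γ : ℕ → ℝ) (f : X → ℂ) (x : X) :
    multOp μ φ s (fun j => β j - γ j) f x = multOp μ φ s β f x - multOp μ φ s γ f x := by
  simp only [multOp]
  rw [← Finset.sum_sub_distrib]
  refine Finset.sum_congr rfl fun j _ => ?_
  push_cast; ring

omit [MetricSpace X] [CompactSpace X] [BorelSpace X] [IsProbabilityMeasure μ] in
lemma multOp_const_mul (s : Finset ℕ) (a : ℝ) (β : ℕ → ℝ) (f : X → ℂ) (x : X) :
    multOp μ φ s (fun j => a * β j) f x = a * multOp μ φ s β f x := by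
  simp only [multOp]
  rw [Finset.mul_sum]
  refine Finset.sum_congr rfl fun j _ => ?_
  push_cast; ring

/-- A multiplier that is `1` on the spectrum of a diffusion polynomial fixes it. -/
lemma multOp_eq_self (hsys : IsDiffusionSystem μ φ ℓ) {L : ℝ} {P : X → ℂ}
    (hP : P ∈ diffPoly φ ℓ L) {s : Finset ℕ} (hs : lowFreq ℓ L ⊆ s) {β : ℕ → ℝ}
    (hβ : ∀ j, ℓ j ≤ L → β j = 1) : multOp μ φ s β P = P := by
  conv_rhs => rw [eq_sum_coeff_of_mem_diffPoly hsys hP]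
  ext x
  simp only [multOp]
  rw [← Finset.sum_subset hs]
  · refine Finset.sum_congr rfl fun j hj => ?_
    rw [hβ j (hsys.mem_lowFreq.1 hj)]; simp
  · intro j _ hj
    rw [hsys.mem_lowFreq, not_le] at hj
    rw [coeff_eq_zero_of_mem_diffPoly hsys hP hj]; simp

lemma multOp_eq_integral (hsys : IsDiffusionSystem μ φ ℓ) (s : Finset ℕ) (β : ℕ → ℝ)
    {f : X → ℂ} (hf : Continuous f) (x : X) :
    multOp μ φ s β f x = ∫ y, f y * ((∑ j ∈ s, β j * φ j x * φ j y : ℝ) : ℂ) ∂μ := by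
  have h1 : ∀ y, f y * ((∑ j ∈ s, β j * φ j x * φ j y : ℝ) : ℂ) =
      ∑ j ∈ s, ((β j : ℂ) * (φ j x : ℂ)) * (f y * (φ j y : ℂ)) := by
    intro y; push_cast; rw [Finset.mul_sum]; exact Finset.sum_congr rfl fun j _ => by ring
  simp only [h1]
  rw [integral_finsetSum]
  · refine Finset.sum_congr rfl fun j _ => ?_
    rw [integral_const_mul, coeff]; ring
  · intro j _
    exact (integrable_of_continuous (hf.mul (hsys.continuous_ofReal j))).const_mul _

lemma norm_multOp_le (hsys : IsDiffusionSystem μ φ ℓ) {s : Finset ℕ} {β : ℕ → ℝ}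
    (hβ : ∀ j, j ∉ s → β j = 0) {c : ℝ} (hc : 0 ≤ c) {x : X}
    (hk : ∫⁻ y, ‖∑' j, β j * φ j x * φ j y‖ₑ ∂μ ≤ ENNReal.ofReal c)
    {f : X → ℂ} (hf : Continuous f) {D : ℝ} (hD : ∀ x, ‖f x‖ ≤ D) :
    ‖multOp μ φ s β f x‖ ≤ c * D := by
  have hD0 : 0 ≤ D := (norm_nonneg _).trans (hD x)
  have hsum : ∀ y, ∑' j, β j * φ j x * φ j y = ∑ j ∈ s, β j * φ j x * φ j y := fun y =>
    tsum_eq_sum fun j hj => by rw [hβ j hj]; simp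
  rw [multOp_eq_integral hsys s β hf, ← ENNReal.ofReal_le_ofReal_iff (by positivity), ofReal_norm]
  refine (enorm_integral_le_lintegral_enorm _).trans ?_
  simp only [hsum] at hk
  calc _ ≤ ∫⁻ y, ENNReal.ofReal D * ‖∑ j ∈ s, β j * φ j x * φ j y‖ₑ ∂μ := by
        refine lintegral_mono fun y => ?_
        rw [enorm_mul, ← ofReal_norm ((_ : ℝ) : ℂ), Complex.norm_real,
          ofReal_norm]
        gcongr
        rw [← ofReal_norm]
        exact ENNReal.ofReal_le_ofReal (hD y)
    _ = ENNReal.ofReal D * ∫⁻ y, ‖∑ j ∈ s, β j * φ j x * φ j y‖ₑ ∂μ :=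
        lintegral_const_mul' _ _ ENNReal.ofReal_ne_top
    _ ≤ ENNReal.ofReal D * ENNReal.ofReal c := by gcongr
    _ = _ := by rw [← ENNReal.ofReal_mul hD0, mul_comm]

end multOp

end

/-! ### Low-pass operators: direct and inverse estimates -/

section

variable {X : Type*} [MetricSpace X] [CompactSpace X] [MeasurableSpace X] [BorelSpace X]
  {μ : Measure X} [IsProbabilityMeasure μ] {φ : ℕ → X → ℝ} {ℓ : ℕ → ℝ} {α : ℝ}

lemma IsFilter.nonneg {h : ℝ → ℝ} (hh : IsFilter h) {t : ℝ} (ht : 0 ≤ t) : 0 ≤ h t := by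
  rcases le_total t 1 with h1 | h1
  · have := hh.antitone (Set.mem_Ici.2 ht) (Set.mem_Ici.2 zero_le_one) h1
    rwa [hh.eq_zero 1 (by simp)] at this
  · rw [hh.eq_zero t (by rwa [abs_of_nonneg ht])]

lemma IsFilter.le_one {h : ℝ → ℝ} (hh : IsFilter h) {t : ℝ} (ht : 0 ≤ t) : h t ≤ 1 := by
  have := hh.antitone (Set.mem_Ici.2 le_rfl) (Set.mem_Ici.2 ht) ht
  rwa [hh.eq_one 0 (by norm_num)] at this

omit [CompactSpace X] [BorelSpace X] [IsProbabilityMeasure μ] in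
lemma BallMeasureCond.exists_regular (hball : BallMeasureCond μ α) :
    ∃ K : ℝ, 0 ≤ K ∧ ∀ M : ℝ, 0 < M → ∀ x : X, ∀ ρ : ℝ, 0 < ρ →
      μ (Metric.closedBall x ρ) ≤ ENNReal.ofReal (K * (ρ ^ α + M ^ (-α))) := by
  obtain ⟨C, hC⟩ := hball
  refine ⟨|C|, abs_nonneg C, fun M hM x ρ hρ => (hC x ρ hρ).trans (ENNReal.ofReal_le_ofReal ?_)⟩
  have h1 : 0 ≤ M ^ (-α) := by positivity
  have h2 : 0 ≤ ρ ^ α := by positivity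
  calc C * ρ ^ α ≤ |C| * ρ ^ α := by gcongr; exact le_abs_self C
    _ ≤ |C| * (ρ ^ α + M ^ (-α)) := by gcongr; linarith

lemma HeatBound.exists_multOp_bound (hsys : IsDiffusionSystem μ φ ℓ) (hα : 0 < α)
    (hball : BallMeasureCond μ α) {C κ : ℝ} (hC : 0 < C) (hκ : 0 < κ) (hH : HeatBound φ ℓ α C κ)
    {b : ℝ → ℝ → ℝ} (hb : ContDiff ℝ ∞ (Function.uncurry b)) {V : ℝ}
    (hV : ∀ δ v, V ≤ v → b δ v = 0) (E : ℝ) {M₀ : ℝ} (hM₀ : 0 < M₀) :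
    ∃ c : ℝ, 0 < c ∧ ∀ δ ∈ Set.Icc 0 E, ∀ M : ℝ, M₀ ≤ M → ∀ s : Finset ℕ,
      (∀ j, j ∉ s → b δ ((ℓ j / M) ^ 2) = 0) → ∀ f : X → ℂ, Continuous f → ∀ D : ℝ,
      (∀ x, ‖f x‖ ≤ D) → ∀ x, ‖multOp μ φ s (fun j => b δ ((ℓ j / M) ^ 2)) f x‖ ≤ c * D := by
  obtain ⟨K, hK, hreg⟩ := hball.exists_regular
  obtain ⟨c, hc, hker⟩ := hH.exists_kernel_bound hα hC hκ hb hV E hM₀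
  refine ⟨c * (K + 1), by positivity, fun δ hδ M hM s hs f hf D hD x => ?_⟩
  have h1 := hker δ hδ M hM K hK μ (hreg M (hM₀.trans_le hM)) x
  refine norm_multOp_le hsys hs (by positivity) (h1.trans (ENNReal.ofReal_le_ofReal ?_)) hf hD
  gcongr
  linarith

omit [CompactSpace X] [BorelSpace X] [IsProbabilityMeasure μ] in
lemma IsFilter.lowPass_eq_zero (hsys : IsDiffusionSystem μ φ ℓ) {h : ℝ → ℝ} (hh : IsFilter h)
    {M M' : ℝ} (hM : 0 < M) (hMM : M ≤ M') {j : ℕ} (hj : j ∉ lowFreq ℓ M') :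
    h (ℓ j / M) = 0 := by
  rw [hsys.mem_lowFreq, not_le] at hj
  have h0 := hsys.ell_nonneg j
  apply hh.eq_zero
  rw [abs_of_nonneg (by positivity), le_div_iff₀ hM]
  linarith

/-- The operators `f ↦ ∑ j, h(ℓ_j / M) ⟨f, φ_j⟩ φ_j` are uniformly bounded in the sup norm. -/
lemma HeatBound.exists_lowPass_bound (hsys : IsDiffusionSystem μ φ ℓ) (hα : 0 < α)
    (hball : BallMeasureCond μ α) {C κ : ℝ} (hC : 0 < C) (hκ : 0 < κ) (hH : HeatBound φ ℓ α C κ)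
    {h : ℝ → ℝ} (hh : IsFilter h) {M₀ : ℝ} (hM₀ : 0 < M₀) :
    ∃ c : ℝ, 0 < c ∧ ∀ M : ℝ, M₀ ≤ M → ∀ f : X → ℂ, Continuous f → ∀ D : ℝ,
      (∀ x, ‖f x‖ ≤ D) → ∀ x, ‖multOp μ φ (lowFreq ℓ M) (fun j => h (ℓ j / M)) f x‖ ≤ c * D := by
  obtain ⟨c, hc, H⟩ := hH.exists_multOp_bound hsys hα hball hC hκ (contDiff_filter_sqrt hh)
    (V := 1) (fun _ v hv => hh.eq_zero _ (by
      rw [abs_of_nonneg (Real.sqrt_nonneg v)]; exact Real.one_le_sqrt.2 hv)) 0 hM₀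
  refine ⟨c, hc, fun M hM f hf D hD x => ?_⟩
  have hM0 : 0 < M := hM₀.trans_le hM
  have hsq : ∀ j, √((ℓ j / M) ^ 2) = ℓ j / M := fun j =>
    Real.sqrt_sq (div_nonneg (hsys.ell_nonneg j) hM0.le)
  have := H 0 (by simp) M hM (lowFreq ℓ M) (fun j hj => by
    rw [hsq]; exact hh.lowPass_eq_zero hsys hM0 le_rfl hj) f hf D hD x
  simpa only [hsq] using this

/-- The band `M / 2 ≤ ℓ_j ≤ 2 M`, weighted by `(1 + ℓ_j) ^ q`, has norm `O(M ^ q)`. -/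
lemma HeatBound.exists_band_bound (hsys : IsDiffusionSystem μ φ ℓ) (hα : 0 < α)
    (hball : BallMeasureCond μ α) {C κ : ℝ} (hC : 0 < C) (hκ : 0 < κ) (hH : HeatBound φ ℓ α C κ)
    {h : ℝ → ℝ} (hh : IsFilter h) (q : ℝ) {M₀ : ℝ} (hM₀ : 0 < M₀) :
    ∃ c : ℝ, 0 < c ∧ ∀ M : ℝ, M₀ ≤ M → ∀ s : Finset ℕ, lowFreq ℓ (2 * M) ⊆ s →
      ∀ f : X → ℂ, Continuous f → ∀ D : ℝ, (∀ x, ‖f x‖ ≤ D) →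
      ∀ x, ‖multOp μ φ s (fun j => (h (ℓ j / (2 * M)) - h (ℓ j / M)) * (1 + ℓ j) ^ q) f x‖ ≤
        c * M ^ q * D := by
  obtain ⟨c, hc, H⟩ := hH.exists_multOp_bound hsys hα hball hC hκ (contDiff_bandSymbol hh q)
    (bandSymbol_eq_zero hh q) (√(1 / M₀)) hM₀
  refine ⟨c, hc, fun M hM s hs f hf D hD x => ?_⟩
  have hM0 : 0 < M := hM₀.trans_le hM
  have hsym : ∀ j, (h (ℓ j / (2 * M)) - h (ℓ j / M)) * (1 + ℓ j) ^ q =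
      M ^ q * bandSymbol h q (√(1 / M)) ((ℓ j / M) ^ 2) := by
    intro j
    have h0 := hsys.ell_nonneg j
    rw [bandSymbol, Real.sqrt_sq (by positivity), Real.sq_sqrt (by positivity),
      show 1 / M + ℓ j / M = (1 + ℓ j) / M by ring, Real.div_rpow (by positivity) hM0.le,
      show ℓ j / M / 2 = ℓ j / (2 * M) by field_simp]
    have : M ^ q ≠ 0 := by positivity
    field_simp
  simp only [hsym]
  rw [multOp_const_mul, norm_mul, Complex.norm_real, Real.norm_of_nonneg (by positivity),
    mul_comm c, mul_assoc]
  gcongr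
  refine H _ ⟨Real.sqrt_nonneg _, by gcongr⟩ M hM s (fun j hj => ?_) f hf D hD x
  have h1 : j ∉ lowFreq ℓ (2 * M) := fun hmem => hj (hs hmem)
  have h2 := hsym j
  rw [hh.lowPass_eq_zero hsys (by positivity : 0 < 2 * M) le_rfl h1,
    hh.lowPass_eq_zero hsys hM0 (by linarith) h1, sub_self, zero_mul] at h2
  exact (mul_eq_zero.1 h2.symm).resolve_left (by positivity)

/-- The low-pass operators converge uniformly on `X^∞`. -/
lemma tendsto_lowPass (hsys : IsDiffusionSystem μ φ ℓ) [μ.IsOpenPosMeasure] {h : ℝ → ℝ}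
    (hh : IsFilter h) {M₀ c : ℝ} (hM₀ : 0 < M₀) (hc : 0 ≤ c)
    (hbd : ∀ M : ℝ, M₀ ≤ M → ∀ f : X → ℂ, Continuous f → ∀ D : ℝ,
      (∀ x, ‖f x‖ ≤ D) → ∀ x, ‖multOp μ φ (lowFreq ℓ M) (fun j => h (ℓ j / M)) f x‖ ≤ c * D)
    {f : X → ℂ} (hf : f ∈ XInf μ φ ℓ) (x : X) :
    Tendsto (fun M => multOp μ φ (lowFreq ℓ M) (fun j => h (ℓ j / M)) f x) atTop (𝓝 (f x)) := by
  rw [Metric.tendsto_nhds]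
  intro ε hε
  obtain ⟨K, P, hP, hPε⟩ := hf.2 (ε / (2 * (c + 1))) (by positivity)
  have hPc := continuous_of_mem_diffPoly hsys hP
  have hfP : Continuous fun x => f x - P x := hf.1.sub hPc
  have hclose := (eLpNorm_top_le_iff (μ := μ) hfP (by positivity)).1 hPε
  filter_upwards [eventually_ge_atTop M₀, eventually_ge_atTop (2 * K)] with M hM hMK
  have hM0 : 0 < M := hM₀.trans_le hM
  have hfix : multOp μ φ (lowFreq ℓ M) (fun j => h (ℓ j / M)) P = P := by
    refine multOp_eq_self hsys hP (fun j hj => ?_) fun j hj => ?_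
    · rw [hsys.mem_lowFreq] at hj ⊢
      have := hsys.ell_nonneg j
      linarith
    · have := hsys.ell_nonneg j
      apply hh.eq_one
      rw [abs_of_nonneg (by positivity), div_le_iff₀ hM0]
      linarith
  have h1 := hbd M hM _ hfP _ hclose x
  rw [multOp_sub hsys _ _ hf.1 hPc, hfix] at h1
  rw [dist_eq_norm]
  calc _ = ‖(multOp μ φ (lowFreq ℓ M) (fun j => h (ℓ j / M)) f x - P x) - (f x - P x)‖ := by
        congr 1; ring
    _ ≤ c * (ε / (2 * (c + 1))) + ε / (2 * (c + 1)) :=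
        (norm_sub_le _ _).trans (add_le_add h1 (hclose x))
    _ = ε / 2 := by field_simp
    _ < ε := by linarith

/-- Jackson-type estimate for the low-pass operators, from the dyadic decomposition
`f - σ_L f = ∑ k, (σ_{2^{k+1} L} f - σ_{2^k L} f)`. -/
lemma HeatBound.exists_direct (hsys : IsDiffusionSystem μ φ ℓ) (hα : 0 < α)
    (hball : BallMeasureCond μ α) {C κ : ℝ} (hC : 0 < C) (hκ : 0 < κ) (hH : HeatBound φ ℓ α C κ)
    {h : ℝ → ℝ} (hh : IsFilter h) {r : ℝ} (hr : 0 < r) {M₀ : ℝ} (hM₀ : 0 < M₀) :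
    ∃ c : ℝ, 0 < c ∧ ∀ M : ℝ, M₀ ≤ M → ∀ f g : X → ℂ, IsDeltaStar μ φ ℓ r f g → ∀ D : ℝ,
      (∀ x, ‖g x‖ ≤ D) →
      ∀ x, ‖f x - multOp μ φ (lowFreq ℓ M) (fun j => h (ℓ j / M)) f x‖ ≤ c * M ^ (-r) * D := by
  have := hH.isOpenPosMeasure hsys hκ
  obtain ⟨c₀, hc₀, hlow⟩ := hH.exists_lowPass_bound hsys hα hball hC hκ hh hM₀
  obtain ⟨c, hc, hband⟩ := hH.exists_band_bound hsys hα hball hC hκ hh (-r) hM₀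
  set q : ℝ := 2 ^ (-r) with hq
  have hq0 : 0 < q := by positivity
  have hq1 : q < 1 := Real.rpow_lt_one_of_one_lt_of_neg (by norm_num) (by linarith)
  have hq1' : 0 < 1 - q := by linarith
  refine ⟨c * (1 - q)⁻¹, by positivity, fun M hM f g hfg D hD x => ?_⟩
  have hM0 : 0 < M := hM₀.trans_le hM
  have hD0 : 0 ≤ D := (norm_nonneg _).trans (hD x)
  set σ : ℝ → ℂ := fun M => multOp μ φ (lowFreq ℓ M) (fun j => h (ℓ j / M)) f x with hσ
  have hstep : ∀ M', M₀ ≤ M' → ‖σ (2 * M') - σ M'‖ ≤ c * M' ^ (-r) * D := by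
    intro M' hM'
    have hM'0 : 0 < M' := hM₀.trans_le hM'
    have hsub : lowFreq ℓ M' ⊆ lowFreq ℓ (2 * M') := fun j hj => by
      rw [hsys.mem_lowFreq] at hj ⊢; linarith
    have h1 : σ M' = multOp μ φ (lowFreq ℓ (2 * M')) (fun j => h (ℓ j / M')) f x := by
      rw [multOp_of_subset hsub fun j _ hj => hh.lowPass_eq_zero hsys hM'0 le_rfl hj]
    have h2 := hband M' hM' _ subset_rfl g hfg.right_mem.1 D hD x
    have h3 : multOp μ φ (lowFreq ℓ (2 * M'))
        (fun j => (h (ℓ j / (2 * M')) - h (ℓ j / M')) * (1 + ℓ j) ^ (-r)) g x =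
        σ (2 * M') - σ M' := by
      rw [h1, hσ]
      simp only
      rw [← multOp_sub_symbol]
      refine Finset.sum_congr rfl fun j _ => ?_
      have h0 := hsys.ell_nonneg j
      have h4 : (1 + ℓ j) ^ (-r) * (1 + ℓ j) ^ r = 1 := by
        rw [← Real.rpow_add (by positivity)]; simp
      rw [hfg.coeff_eq]
      have h5 : (((1 + ℓ j) ^ (-r) : ℝ) : ℂ) * (((1 + ℓ j) ^ r : ℝ) : ℂ) = 1 := by
        rw [← Complex.ofReal_mul, h4, Complex.ofReal_one]
      rw [Complex.ofReal_mul]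
      linear_combination ((h (ℓ j / (2 * M')) - h (ℓ j / M') : ℝ) : ℂ) * coeff μ φ f j *
        (φ j x : ℂ) * h5
    rwa [h3] at h2
  have htel : ∀ k : ℕ, ‖σ (2 ^ k * M) - σ M‖ ≤ c * (1 - q)⁻¹ * M ^ (-r) * D := by
    intro k
    have hgeo : ∑ i ∈ Finset.range k, q ^ i ≤ (1 - q)⁻¹ := by
      rw [← tsum_geometric_of_lt_one hq0.le hq1]
      exact (summable_geometric_of_lt_one hq0.le hq1).sum_le_tsum _ fun _ _ => by positivity
    have hsum : σ (2 ^ k * M) - σ M =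
        ∑ i ∈ Finset.range k, (σ (2 * (2 ^ i * M)) - σ (2 ^ i * M)) := by
      have := Finset.sum_range_sub (fun i : ℕ => σ (2 ^ i * M)) k
      simp only [pow_succ', mul_assoc, pow_zero, one_mul] at this
      exact this.symm
    rw [hsum]
    calc _ ≤ ∑ i ∈ Finset.range k, ‖σ (2 * (2 ^ i * M)) - σ (2 ^ i * M)‖ := norm_sum_le _ _
      _ ≤ ∑ i ∈ Finset.range k, c * M ^ (-r) * D * q ^ i := by
        refine Finset.sum_le_sum fun i _ => ?_
        have h2 : (1 : ℝ) ≤ 2 ^ i := one_le_pow₀ (by norm_num)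
        refine (hstep (2 ^ i * M) (by nlinarith)).trans_eq ?_
        rw [Real.mul_rpow (by positivity) hM0.le, hq, ← Real.rpow_natCast 2 i,
          ← Real.rpow_natCast ((2 : ℝ) ^ (-r)) i, ← Real.rpow_mul (by norm_num),
          ← Real.rpow_mul (by norm_num), mul_comm (i : ℝ)]
        ring
      _ = c * M ^ (-r) * D * ∑ i ∈ Finset.range k, q ^ i := by rw [Finset.mul_sum]
      _ ≤ c * M ^ (-r) * D * (1 - q)⁻¹ := by gcongr
      _ = _ := by ring
  have hlim : Tendsto (fun k : ℕ => σ (2 ^ k * M)) atTop (𝓝 (f x)) := by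
    refine (tendsto_lowPass hsys hh hM₀ hc₀.le hlow hfg.left_mem x).comp ?_
    exact (tendsto_pow_atTop_atTop_of_one_lt one_lt_two).atTop_mul_const hM0
  exact le_of_tendsto ((hlim.sub_const (σ M)).norm) (Eventually.of_forall htel)

/-- Bernstein-type inequality for `(Δ^*)^r` on diffusion polynomials. The symbol
`(1 + ℓ) ^ r` is not smooth at the origin, so it is decomposed into dyadic bands, and the
frequencies below a fixed level are estimated termwise. -/
lemma HeatBound.exists_bernstein (hsys : IsDiffusionSystem μ φ ℓ) (hα : 0 < α)
    (hball : BallMeasureCond μ α) {C κ : ℝ} (hC : 0 < C) (hκ : 0 < κ) (hH : HeatBound φ ℓ α C κ)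
    {h : ℝ → ℝ} (hh : IsFilter h) {r : ℝ} (hr : 0 < r) {M₀ : ℝ} (hM₀ : 0 < M₀) :
    ∃ c : ℝ, 0 < c ∧ ∀ M : ℝ, M₀ ≤ M → ∀ P ∈ diffPoly φ ℓ M, ∀ D : ℝ, (∀ x, ‖P x‖ ≤ D) →
      ∀ x, ‖multOp μ φ (lowFreq ℓ M) (fun j => (1 + ℓ j) ^ r) P x‖ ≤ c * M ^ r * D := by
  obtain ⟨c, hc, hband⟩ := hH.exists_band_bound hsys hα hball hC hκ hh r hM₀
  obtain ⟨c₁, hc₁, hsq⟩ := hH.exists_sum_sq_le hsys hC hM₀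
  set q : ℝ := 2 ^ r with hq
  have hq1 : 1 < q := Real.one_lt_rpow (by norm_num) hr
  have hq0 : 0 < q - 1 := by linarith
  set Z : ℝ := ∑ j ∈ lowFreq ℓ M₀, (1 + ℓ j) ^ r * (1 + c₁ * M₀ ^ α) with hZ
  have hZ0 : 0 ≤ Z := Finset.sum_nonneg fun j _ => by
    have := hsys.ell_nonneg j
    positivity
  refine ⟨Z * M₀ ^ (-r) + c * 4 ^ r / (q - 1), by positivity, fun M hM P hP D hD x => ?_⟩
  have hM0 : 0 < M := hM₀.trans_le hM
  have hD0 : 0 ≤ D := (norm_nonneg _).trans (hD x)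
  have hPc := continuous_of_mem_diffPoly hsys hP
  -- The top dyadic level `2 ^ (n + 1) M₀` lies in `(2 M, 4 M]`, so its low-pass filter is `1` on
  -- `Π_M`.
  obtain ⟨n, hn1, hn2⟩ := exists_nat_pow_near (x := 2 * M / M₀) (y := 2)
    (by rw [le_div_iff₀ hM₀]; linarith) one_lt_two
  rw [le_div_iff₀ hM₀] at hn1
  rw [div_lt_iff₀ hM₀] at hn2
  set m : ℕ → ℝ := fun i => 2 ^ i * M₀ with hm
  have hm0 : ∀ i, 0 < m i := fun i => by positivity
  have hmM₀ : ∀ i, M₀ ≤ m i := fun i => by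
    have : (1 : ℝ) ≤ 2 ^ i := one_le_pow₀ (by norm_num)
    simp only [hm]; nlinarith
  have hms : ∀ i, m (i + 1) = 2 * m i := fun i => by simp only [hm, pow_succ']; ring
  set s := lowFreq ℓ (m (n + 1)) with hs
  have hmono : ∀ i, i ≤ n → 2 * m i ≤ m (n + 1) := fun i hi => by
    rw [← hms]
    simp only [hm]
    gcongr
    · norm_num
  have hMs : lowFreq ℓ M ⊆ s := fun j hj => by
    rw [hsys.mem_lowFreq] at hj ⊢; simp only [hm]; linarith
  have hdecomp : multOp μ φ (lowFreq ℓ M) (fun j => (1 + ℓ j) ^ r) P x =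
      multOp μ φ (lowFreq ℓ M₀) (fun j => h (ℓ j / M₀) * (1 + ℓ j) ^ r) P x +
      ∑ i ∈ Finset.range (n + 1),
        multOp μ φ s (fun j => (h (ℓ j / (2 * m i)) - h (ℓ j / m i)) * (1 + ℓ j) ^ r) P x := by
    have e1 : multOp μ φ (lowFreq ℓ M₀) (fun j => h (ℓ j / M₀) * (1 + ℓ j) ^ r) P x =
        multOp μ φ s (fun j => h (ℓ j / M₀) * (1 + ℓ j) ^ r) P x := by
      rw [multOp_of_subset (s := lowFreq ℓ M₀) (t := s)]
      · intro j hj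
        rw [hsys.mem_lowFreq] at hj ⊢
        exact hj.trans (hmM₀ _)
      · intro j _ hj
        rw [hh.lowPass_eq_zero hsys hM₀ le_rfl hj, zero_mul]
    have e2 : multOp μ φ (lowFreq ℓ M) (fun j => (1 + ℓ j) ^ r) P x =
        multOp μ φ s (fun j => h (ℓ j / m (n + 1)) * (1 + ℓ j) ^ r) P x := by
      simp only [multOp]
      rw [← Finset.sum_subset hMs]
      · refine Finset.sum_congr rfl fun j hj => ?_
        rw [hsys.mem_lowFreq] at hj
        have := hsys.ell_nonneg j
        have hm1 := hm0 (n + 1)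
        rw [hh.eq_one, one_mul]
        rw [abs_of_nonneg (by positivity), div_le_iff₀ hm1]
        simp only [hm]; linarith
      · intro j _ hj
        rw [hsys.mem_lowFreq, not_le] at hj
        rw [coeff_eq_zero_of_mem_diffPoly hsys hP hj]; simp
    rw [e1, e2]
    simp only [multOp]
    rw [Finset.sum_comm, ← Finset.sum_add_distrib]
    refine Finset.sum_congr rfl fun j _ => ?_
    rw [← Finset.sum_mul, ← Finset.sum_mul, ← add_mul, ← add_mul, ← Complex.ofReal_sum,
      ← Complex.ofReal_add]
    congr 3
    rw [← Finset.sum_mul, ← add_mul]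
    congr 1
    have := Finset.sum_range_sub (fun i : ℕ => h (ℓ j / m i)) (n + 1)
    simp only [hms] at this ⊢
    rw [this]
    simp [hm]
  have hlow : ‖multOp μ φ (lowFreq ℓ M₀) (fun j => h (ℓ j / M₀) * (1 + ℓ j) ^ r) P x‖ ≤ Z * D := by
    rw [hZ, Finset.sum_mul]
    refine (norm_sum_le _ _).trans (Finset.sum_le_sum fun j hj => ?_)
    have h0 := hsys.ell_nonneg j
    have hh0 := hh.nonneg (t := ℓ j / M₀) (by positivity)
    have hh1 := hh.le_one (t := ℓ j / M₀) (by positivity)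
    rw [norm_mul, norm_mul, Complex.norm_real, Complex.norm_real, Real.norm_of_nonneg
      (by positivity), Real.norm_eq_abs]
    have h1 := norm_coeff_le hsys hD j
    have h2 : φ j x ^ 2 ≤ c₁ * M₀ ^ α := by
      simpa using hsq M₀ le_rfl {j} (by simpa using hsys.mem_lowFreq.1 hj) x
    have h3 : |φ j x| ≤ 1 + c₁ * M₀ ^ α := by
      rw [abs_le]; constructor <;> nlinarith [sq_nonneg (φ j x - 1), sq_nonneg (φ j x + 1)]
    calc h (ℓ j / M₀) * (1 + ℓ j) ^ r * ‖coeff μ φ P j‖ * |φ j x|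
        ≤ 1 * (1 + ℓ j) ^ r * D * (1 + c₁ * M₀ ^ α) := by gcongr
      _ = _ := by ring
  have hbands : ∀ i ∈ Finset.range (n + 1), ‖multOp μ φ s
      (fun j => (h (ℓ j / (2 * m i)) - h (ℓ j / m i)) * (1 + ℓ j) ^ r) P x‖ ≤
        c * M₀ ^ r * D * q ^ i := by
    intro i hi
    have hi' : i ≤ n := by simpa [Nat.lt_succ_iff] using hi
    refine (hband (m i) (hmM₀ i) s (fun j hj => ?_) P hPc D hD x).trans_eq ?_
    · rw [hsys.mem_lowFreq] at hj ⊢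
      exact hj.trans (hmono i hi')
    · simp only [hm]
      rw [Real.mul_rpow (by positivity) hM₀.le, hq, ← Real.rpow_natCast 2 i,
        ← Real.rpow_natCast ((2 : ℝ) ^ r) i, ← Real.rpow_mul (by norm_num),
        ← Real.rpow_mul (by norm_num), mul_comm (i : ℝ)]
      ring
  have hgeo : ∑ i ∈ Finset.range (n + 1), q ^ i ≤ q ^ (n + 1) / (q - 1) := by
    rw [geom_sum_eq hq1.ne']
    gcongr
    linarith
  have hpow : M₀ ^ r * q ^ (n + 1) ≤ 4 ^ r * M ^ r := by
    rw [hq, ← Real.rpow_natCast, ← Real.rpow_mul (by norm_num), mul_comm r, Real.rpow_mul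
      (by norm_num), ← Real.mul_rpow hM₀.le (by positivity), ← Real.mul_rpow (by norm_num) hM0.le,
      Real.rpow_natCast]
    apply Real.rpow_le_rpow (by positivity) _ hr.le
    rw [pow_succ]; linarith
  have hMr : 1 ≤ M₀ ^ (-r) * M ^ r := by
    rw [Real.rpow_neg hM₀.le, inv_mul_eq_div, one_le_div (by positivity)]
    gcongr
  rw [hdecomp]
  calc _ ≤ Z * D + ∑ i ∈ Finset.range (n + 1), c * M₀ ^ r * D * q ^ i :=
        (norm_add_le _ _).trans (add_le_add hlow ((norm_sum_le _ _).trans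
          (Finset.sum_le_sum hbands)))
    _ = Z * D * 1 + c * M₀ ^ r * D * ∑ i ∈ Finset.range (n + 1), q ^ i := by
        rw [Finset.mul_sum, mul_one]
    _ ≤ Z * D * (M₀ ^ (-r) * M ^ r) + c * M₀ ^ r * D * (q ^ (n + 1) / (q - 1)) := by gcongr
    _ = Z * D * (M₀ ^ (-r) * M ^ r) + c * D / (q - 1) * (M₀ ^ r * q ^ (n + 1)) := by ring
    _ ≤ Z * D * (M₀ ^ (-r) * M ^ r) + c * D / (q - 1) * (4 ^ r * M ^ r) := by gcongr
    _ = _ := by ring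

end

/-! ### Product approximation and discretized operators -/

section

variable {X : Type*} [MetricSpace X] [CompactSpace X] [MeasurableSpace X] [BorelSpace X]
  {μ : Measure X} [IsProbabilityMeasure μ] {φ : ℕ → X → ℝ} {ℓ : ℕ → ℝ} {α : ℝ}

omit [CompactSpace X] [BorelSpace X] [IsProbabilityMeasure μ] in
/-- Under the product assumption, products `φ_j φ_k` with `ℓ_j, ℓ_k ≤ L` are uniformly close to
`Π_{AL}`, faster than any power of `L`. -/
lemma exists_product_approx (hsys : IsDiffusionSystem μ φ ℓ) [μ.IsOpenPosMeasure] {A : ℝ}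
    (hprod : ProductAssumption μ φ ℓ A) {M₀ c : ℝ} (hM₀ : 0 < M₀) (hc : 0 < c)
    (hsq : ∀ M : ℝ, M₀ ≤ M → ∀ s : Finset ℕ, (∀ j ∈ s, ℓ j ≤ M) →
      ∀ x, ∑ j ∈ s, φ j x ^ 2 ≤ c * M ^ α) {s : ℝ} (hs : 0 < s) :
    ∃ c' : ℝ, 0 < c' ∧ ∀ L : ℝ, M₀ ≤ L → ∀ j k : ℕ, ℓ j ≤ L → ℓ k ≤ L →
      ∃ Q ∈ diffPoly φ ℓ (A * L), ∀ x, ‖(φ j x : ℂ) * (φ k x : ℂ) - Q x‖ ≤ c' * L ^ (-s) := by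
  obtain ⟨L₁, hL₁⟩ := eventually_atTop.1 ((hprod.2 s hs).eventually (gt_mem_nhds one_pos))
  set L₂ := max L₁ M₀ with hL₂
  have hL₂0 : 0 < L₂ := hM₀.trans_le (le_max_right _ _)
  refine ⟨1 + c * L₂ ^ α * L₂ ^ s, by positivity, fun L hL j k hj hk => ?_⟩
  have hL0 : 0 < L := hM₀.trans_le hL
  have hLs : 0 < L ^ (-s) := by positivity
  -- For `L ≤ L₂` the zero polynomial is good enough, at the cost of a larger constant.
  rcases le_total L₂ L with h | h
  · have h1 := hL₁ L ((le_max_left _ _).trans h)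
    have h2 : productError μ φ ℓ A L < ENNReal.ofReal (L ^ (-s)) := by
      rw [Real.rpow_neg hL0.le, ENNReal.ofReal_inv_of_pos (by positivity)]
      have h3 : ENNReal.ofReal (L ^ s) ≠ 0 := by
        rw [Ne, ENNReal.ofReal_eq_zero, not_le]; positivity
      rwa [← one_div, ENNReal.lt_div_iff_mul_lt (Or.inl h3) (Or.inl ENNReal.ofReal_ne_top),
        mul_comm]
    have h4 : distPoly μ φ ℓ (fun x => (φ j x : ℂ) * (φ k x : ℂ)) (A * L) <
        ENNReal.ofReal (L ^ (-s)) := by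
      refine lt_of_le_of_lt ?_ h2
      exact le_iSup_of_le j (le_iSup_of_le k (le_iSup_of_le hj (le_iSup_of_le hk le_rfl)))
    obtain ⟨Q, hQ⟩ := iInf_lt_iff.1 h4
    obtain ⟨hQm, hQ⟩ := iInf_lt_iff.1 hQ
    have hQc := continuous_of_mem_diffPoly hsys hQm
    have hcont : Continuous fun x => (φ j x : ℂ) * (φ k x : ℂ) - Q x :=
      ((hsys.continuous_ofReal j).mul (hsys.continuous_ofReal k)).sub hQc
    refine ⟨Q, hQm, fun x => ((eLpNorm_top_le_iff hcont hLs.le).1 hQ.le x).trans ?_⟩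
    refine le_mul_of_one_le_left hLs.le ?_
    have : 0 ≤ c * L₂ ^ α * L₂ ^ s := by positivity
    linarith
  · refine ⟨0, Submodule.zero_mem _, fun x => ?_⟩
    have hb : ∀ i, ℓ i ≤ L → φ i x ^ 2 ≤ c * L₂ ^ α := fun i hi => by
      simpa using hsq L₂ (le_max_right _ _) {i} (by simpa using hi.trans h) x
    have h1 : |φ j x| * |φ k x| ≤ c * L₂ ^ α := by
      have h2 := hb j hj
      have h3 := hb k hk
      rw [← sq_abs] at h2 h3
      nlinarith [sq_nonneg (|φ j x| - |φ k x|)]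
    have h4 : 1 ≤ L₂ ^ s * L ^ (-s) := by
      rw [Real.rpow_neg hL0.le, ← div_eq_mul_inv, one_le_div (by positivity)]
      gcongr
    rw [Pi.zero_apply, sub_zero, norm_mul, Complex.norm_real, Complex.norm_real]
    calc |φ j x| * |φ k x| ≤ c * L₂ ^ α * 1 := by rwa [mul_one]
      _ ≤ c * L₂ ^ α * (L₂ ^ s * L ^ (-s)) := by gcongr
      _ ≤ _ := by rw [add_mul, one_mul, mul_assoc]; linarith

section SignedMeasure

omit [CompactSpace X] [BorelSpace X] [IsProbabilityMeasure μ] in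
lemma BallMeasureCond.exists_variation_ball_le (hball : BallMeasureCond μ α) (N : ℝ) :
    ∃ K : ℝ, 0 ≤ K ∧ ∀ L : ℝ, 0 < L → ∀ ν : SignedMeasure X, IsRegularMeasure μ α (1 / L) N ν →
      ∀ x : X, ∀ ρ : ℝ, 0 < ρ →
        ν.variation (Metric.closedBall x ρ) ≤ ENNReal.ofReal (K * (ρ ^ α + L ^ (-α))) := by
  obtain ⟨C, hC⟩ := hball
  refine ⟨|N| * (|C| + 1), by positivity, fun L hL ν hν x ρ hρ => (hν x ρ hρ).trans ?_⟩
  have hL' : (1 / L) ^ α = L ^ (-α) := by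
    rw [one_div, Real.inv_rpow hL.le, Real.rpow_neg hL.le]
  have h1 : 0 ≤ L ^ (-α) := by positivity
  have h2 : 0 ≤ ρ ^ α := by positivity
  rw [hL']
  calc _ ≤ ENNReal.ofReal |N| * (ENNReal.ofReal (|C| * ρ ^ α) + ENNReal.ofReal (L ^ (-α))) := by
        gcongr
        · exact le_abs_self N
        · refine (hC x ρ hρ).trans (ENNReal.ofReal_le_ofReal ?_)
          gcongr
          exact le_abs_self C
    _ = ENNReal.ofReal (|N| * (|C| * ρ ^ α + L ^ (-α))) := by
        rw [← ENNReal.ofReal_add (by positivity) h1, ← ENNReal.ofReal_mul (abs_nonneg N)]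
    _ ≤ _ := by
        apply ENNReal.ofReal_le_ofReal
        rw [mul_assoc]
        gcongr
        nlinarith [abs_nonneg C, mul_nonneg (abs_nonneg C) h1]

omit [BorelSpace X] [IsProbabilityMeasure μ] in
lemma BallMeasureCond.exists_variation_univ_le [Nonempty X] (hα : 0 < α)
    (hball : BallMeasureCond μ α) (N : ℝ) {M₀ : ℝ} (hM₀ : 0 < M₀) :
    ∃ T : ℝ, 0 ≤ T ∧ ∀ L : ℝ, M₀ ≤ L → ∀ ν : SignedMeasure X,
      IsRegularMeasure μ α (1 / L) N ν → ν.variation Set.univ ≤ ENNReal.ofReal T := by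
  obtain ⟨K, hK, H⟩ := hball.exists_variation_ball_le N
  have hd : 0 ≤ Metric.diam (Set.univ : Set X) := Metric.diam_nonneg
  refine ⟨K * ((Metric.diam (Set.univ : Set X) + 1) ^ α + M₀ ^ (-α)), by positivity,
    fun L hL ν hν => ?_⟩
  obtain ⟨x⟩ := ‹Nonempty X›
  have hsub : Set.univ ⊆ Metric.closedBall x (Metric.diam (Set.univ : Set X) + 1) := fun y _ => by
    rw [Metric.mem_closedBall]
    have := Metric.dist_le_diam_of_mem isCompact_univ.isBounded (Set.mem_univ y) (Set.mem_univ x)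
    linarith
  refine (measure_mono hsub).trans ((H L (hM₀.trans_le hL) ν hν x _ (by positivity)).trans ?_)
  apply ENNReal.ofReal_le_ofReal
  have : L ^ (-α) ≤ M₀ ^ (-α) := Real.rpow_le_rpow_of_nonpos hM₀ hL (by linarith)
  gcongr

omit [MetricSpace X] [CompactSpace X] [BorelSpace X] in
lemma enorm_integral_signedMeasure_le (ν : SignedMeasure X) (u : X → ℂ) :
    ‖∫ᵛ y, u y ∂<•ν‖ₑ ≤ ∫⁻ y, ‖u y‖ₑ ∂ν.variation := by
  have h := VectorMeasure.enorm_integral_le_lintegral_enorm_transpose (μ := ν) (f := u)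
    (B := (ContinuousLinearMap.lsmul ℝ ℝ (E := ℂ)).flip)
  rwa [VectorMeasure.variation_transpose_lsmul_flip] at h

omit [CompactSpace X] [BorelSpace X] [IsProbabilityMeasure μ] in
lemma kernelPhi_eq_sum (hsys : IsDiffusionSystem μ φ ℓ) {h : ℝ → ℝ} (hh : IsFilter h) {L : ℝ}
    (hL : 0 < L) (x y : X) :
    kernelPhi φ ℓ h L x y = ∑ j ∈ lowFreq ℓ L, h (ℓ j / L) * φ j x * φ j y :=
  tsum_eq_sum fun j hj => by rw [hh.lowPass_eq_zero hsys hL le_rfl hj]; simp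

omit [CompactSpace X] [BorelSpace X] [IsProbabilityMeasure μ] in
lemma continuous_kernelPhi (hsys : IsDiffusionSystem μ φ ℓ) {h : ℝ → ℝ} (hh : IsFilter h) {L : ℝ}
    (hL : 0 < L) (x : X) : Continuous fun y => (kernelPhi φ ℓ h L x y : ℂ) := by
  simp only [kernelPhi_eq_sum hsys hh hL]
  exact Complex.continuous_ofReal.comp
    (continuous_finsetSum _ fun j _ => continuous_const.mul (hsys.continuous j))

omit [IsProbabilityMeasure μ] in
lemma sigmaOp_eq_sum (hsys : IsDiffusionSystem μ φ ℓ) {h : ℝ → ℝ} (hh : IsFilter h) {L : ℝ}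
    (hL : 0 < L) (ν : SignedMeasure X) [IsFiniteMeasure ν.variation] {f : X → ℂ}
    (hf : Continuous f) : sigmaOp φ ℓ h L ν f = fun x => ∑ j ∈ lowFreq ℓ L,
      ((h (ℓ j / L) : ℂ) * ∫ᵛ y, f y * (φ j y : ℂ) ∂<•ν) * (φ j x : ℂ) := by
  ext x
  have h1 : ∀ y, f y * (kernelPhi φ ℓ h L x y : ℂ) =
      ∑ j ∈ lowFreq ℓ L, (h (ℓ j / L) * φ j x) • (f y * (φ j y : ℂ)) := by
    intro y
    rw [kernelPhi_eq_sum hsys hh hL]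
    push_cast
    rw [Finset.mul_sum]
    refine Finset.sum_congr rfl fun j _ => ?_
    rw [Complex.real_smul]; push_cast; ring
  simp only [sigmaOp, h1]
  have hi : ∀ j, Integrable (fun y => f y * (φ j y : ℂ)) ν.variation := fun j =>
    integrable_of_continuous (hf.mul (hsys.continuous_ofReal j))
  rw [VectorMeasure.integral_finsetSum (f := fun j y => (h (ℓ j / L) * φ j x) • (f y * (φ j y : ℂ)))
    _ fun j _ => (hi j).smul (h (ℓ j / L) * φ j x)]
  refine Finset.sum_congr rfl fun j _ => ?_
  rw [VectorMeasure.integral_fun_smul, Complex.real_smul]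
  push_cast; ring

omit [IsProbabilityMeasure μ] in
lemma sigmaOp_mem_diffPoly (hsys : IsDiffusionSystem μ φ ℓ) {h : ℝ → ℝ} (hh : IsFilter h) {L : ℝ}
    (hL : 0 < L) (ν : SignedMeasure X) [IsFiniteMeasure ν.variation] {f : X → ℂ}
    (hf : Continuous f) : sigmaOp φ ℓ h L ν f ∈ diffPoly φ ℓ L := by
  rw [sigmaOp_eq_sum hsys hh hL ν hf]
  exact sum_mem_diffPoly (fun j hj => hsys.mem_lowFreq.1 hj) _

omit [IsProbabilityMeasure μ] in
lemma sigmaOp_sub (hsys : IsDiffusionSystem μ φ ℓ) {h : ℝ → ℝ} (hh : IsFilter h) {L : ℝ}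
    (hL : 0 < L) (ν : SignedMeasure X) [IsFiniteMeasure ν.variation] {f g : X → ℂ}
    (hf : Continuous f) (hg : Continuous g) (x : X) :
    sigmaOp φ ℓ h L ν (fun x => f x - g x) x =
      sigmaOp φ ℓ h L ν f x - sigmaOp φ ℓ h L ν g x := by
  have hk := continuous_kernelPhi hsys hh hL x
  simp only [sigmaOp, sub_mul]
  exact VectorMeasure.integral_fun_sub (integrable_of_continuous (hf.mul hk))
    (integrable_of_continuous (hg.mul hk))

omit [IsProbabilityMeasure μ] in
/-- The operators `σ_L(ν)` are bounded in the sup norm, uniformly in `L` and `ν`. -/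
lemma HeatBound.exists_sigmaOp_bound (hsys : IsDiffusionSystem μ φ ℓ) (hα : 0 < α)
    (hball : BallMeasureCond μ α) {C κ : ℝ} (hC : 0 < C) (hκ : 0 < κ) (hH : HeatBound φ ℓ α C κ)
    {h : ℝ → ℝ} (hh : IsFilter h) (N : ℝ) {M₀ : ℝ} (hM₀ : 0 < M₀) :
    ∃ c : ℝ, 0 < c ∧ ∀ L : ℝ, M₀ ≤ L → ∀ ν : SignedMeasure X, IsRegularMeasure μ α (1 / L) N ν →
      ∀ f : X → ℂ, ∀ D : ℝ, (∀ x, ‖f x‖ ≤ D) → ∀ x, ‖sigmaOp φ ℓ h L ν f x‖ ≤ c * D := by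
  obtain ⟨K, hK, hreg⟩ := hball.exists_variation_ball_le N
  obtain ⟨c, hc, hker⟩ := hH.exists_kernel_bound hα hC hκ (contDiff_filter_sqrt hh)
    (V := 1) (fun _ v hv => hh.eq_zero _ (by
      rw [abs_of_nonneg (Real.sqrt_nonneg v)]; exact Real.one_le_sqrt.2 hv)) 0 hM₀
  refine ⟨c * (K + 1), by positivity, fun L hL ν hν f D hD x => ?_⟩
  have hL0 : 0 < L := hM₀.trans_le hL
  have hD0 : 0 ≤ D := (norm_nonneg _).trans (hD x)
  have hsq : ∀ j, √((ℓ j / L) ^ 2) = ℓ j / L := fun j =>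
    Real.sqrt_sq (div_nonneg (hsys.ell_nonneg j) hL0.le)
  have h1 := hker 0 (by simp) L hL K hK ν.variation (hreg L hL0 ν hν) x
  simp only [hsq] at h1
  rw [← ENNReal.ofReal_le_ofReal_iff (by positivity), ofReal_norm, sigmaOp]
  refine (enorm_integral_signedMeasure_le ν _).trans ?_
  calc _ ≤ ∫⁻ y, ENNReal.ofReal D * ‖kernelPhi φ ℓ h L x y‖ₑ ∂ν.variation := by
        refine lintegral_mono fun y => ?_
        rw [enorm_mul, ← ofReal_norm ((_ : ℝ) : ℂ), Complex.norm_real, ofReal_norm]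
        gcongr
        rw [← ofReal_norm]
        exact ENNReal.ofReal_le_ofReal (hD y)
    _ = ENNReal.ofReal D * ∫⁻ y, ‖kernelPhi φ ℓ h L x y‖ₑ ∂ν.variation :=
        lintegral_const_mul' _ _ ENNReal.ofReal_ne_top
    _ ≤ ENNReal.ofReal D * ENNReal.ofReal (c * K) := by gcongr; exact h1
    _ = ENNReal.ofReal (D * (c * K)) := by rw [← ENNReal.ofReal_mul hD0]
    _ ≤ _ := by
        apply ENNReal.ofReal_le_ofReal
        have : 0 ≤ c * D := by positivity
        nlinarith

/-- On diffusion polynomials, the discretized operator `σ_L(ν)` agrees with `σ_L(μ)` up to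
`O(L ^ (-r))`: the integrand `P(y) Φ_L(x, y)` is a combination of `O(L ^ (2 α))` products
`φ_j φ_k`, each of which is nearly in `Π_{AL}`, where the quadrature is exact. -/
lemma HeatBound.exists_quadrature_error (hsys : IsDiffusionSystem μ φ ℓ) (hα : 0 < α)
    (hball : BallMeasureCond μ α) {C κ : ℝ} (hC : 0 < C) (hκ : 0 < κ) (hH : HeatBound φ ℓ α C κ)
    {A : ℝ} (hprod : ProductAssumption μ φ ℓ A) {h : ℝ → ℝ} (hh : IsFilter h) {r : ℝ} (hr : 0 < r)
    (N : ℝ) {M₀ : ℝ} (hM₀ : 0 < M₀) :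
    ∃ c : ℝ, 0 < c ∧ ∀ L : ℝ, M₀ ≤ L → ∀ ν : SignedMeasure X, IsRegularMeasure μ α (1 / L) N ν →
      IsQuadratureMeasure μ φ ℓ (A * L) ν → ∀ P ∈ diffPoly φ ℓ L, ∀ D : ℝ, (∀ x, ‖P x‖ ≤ D) →
      ∀ x, ‖sigmaOp φ ℓ h L ν P x - multOp μ φ (lowFreq ℓ L) (fun j => h (ℓ j / L)) P x‖ ≤
        c * L ^ (-r) * D := by
  have := hH.isOpenPosMeasure hsys hκ
  have : Nonempty X := nonempty_of_isProbabilityMeasure μ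
  obtain ⟨T, hT, hmass⟩ := hball.exists_variation_univ_le hα N hM₀
  obtain ⟨c₁, hc₁, hsq⟩ := hH.exists_sum_sq_le hsys hC hM₀
  obtain ⟨c₂, hc₂, happ⟩ := exists_product_approx hsys hprod hM₀ hc₁ hsq
    (by positivity : 0 < 2 * α + r)
  refine ⟨c₁ ^ 2 * c₂ * (T + 1), by positivity, fun L hL ν hν hquad P hP D hD x => ?_⟩
  have hL0 : 0 < L := hM₀.trans_le hL
  have hD0 : 0 ≤ D := (norm_nonneg _).trans (hD x)
  have hfin : IsFiniteMeasure ν.variation :=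
    ⟨(hmass L hL ν hν).trans_lt ENNReal.ofReal_lt_top⟩
  set s := lowFreq ℓ L with hs
  have hPc := continuous_of_mem_diffPoly hsys hP
  have hk := continuous_kernelPhi hsys hh hL0 x
  have hsL : ∀ j ∈ s, ℓ j ≤ L := fun j hj => hsys.mem_lowFreq.1 hj
  have happ' : ∀ j k : ℕ, ∃ Q ∈ diffPoly φ ℓ (A * L), j ∈ s → k ∈ s →
      ∀ y, ‖(φ j y : ℂ) * (φ k y : ℂ) - Q y‖ ≤ c₂ * L ^ (-(2 * α + r)) := by
    intro j k
    by_cases hj : j ∈ s ∧ k ∈ s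
    · obtain ⟨Q, hQ, hb⟩ := happ L hL j k (hsL j hj.1) (hsL k hj.2)
      exact ⟨Q, hQ, fun _ _ => hb⟩
    · exact ⟨0, Submodule.zero_mem _, fun h1 h2 => absurd ⟨h1, h2⟩ hj⟩
  choose Q hQ hQb using happ'
  set e : ℝ := c₂ * L ^ (-(2 * α + r)) with he
  have he0 : 0 < e := by positivity
  set a : ℕ → ℕ → ℂ := fun j k => coeff μ φ P j * ((h (ℓ k / L) * φ k x : ℝ) : ℂ) with ha
  -- `q ∈ Π_{AL}` approximates the integrand `y ↦ P(y) Φ_L(x, y)` uniformly.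
  set q : X → ℂ := ∑ j ∈ s, ∑ k ∈ s, a j k • Q j k with hq
  have hqmem : q ∈ diffPoly φ ℓ (A * L) :=
    Submodule.sum_mem _ fun j _ => Submodule.sum_mem _ fun k _ => Submodule.smul_mem _ _ (hQ j k)
  have hqc := continuous_of_mem_diffPoly hsys hqmem
  have hcard : (s.card : ℝ) ≤ c₁ * L ^ α := by
    have hi : ∀ j, Integrable (fun y => φ j y ^ 2) μ := fun j =>
      integrable_of_continuous ((hsys.continuous j).pow 2)
    have e1 : ∫ y, ∑ j ∈ s, φ j y ^ 2 ∂μ = s.card := by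
      rw [integral_finsetSum _ fun j _ => hi j]
      simp [sq, hsys.orthonormal]
    rw [← e1]
    calc _ ≤ ∫ _, c₁ * L ^ α ∂μ := integral_mono (integrable_finsetSum _ fun j _ => hi j)
          (integrable_const _) (hsq L hL s hsL)
      _ = _ := by simp
  have hsum1 : ∑ k ∈ s, |φ k x| ≤ c₁ * L ^ α := by
    calc ∑ k ∈ s, |φ k x| ≤ ∑ k ∈ s, (1 + φ k x ^ 2) / 2 := by
          refine Finset.sum_le_sum fun k _ => ?_
          rw [abs_le]; constructor <;> nlinarith [sq_nonneg (φ k x - 1), sq_nonneg (φ k x + 1)]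
      _ = (s.card + ∑ k ∈ s, φ k x ^ 2) / 2 := by
          rw [← Finset.sum_div, Finset.sum_add_distrib]; simp
      _ ≤ _ := by linarith [hsq L hL s hsL x]
  have hdiff : ∀ y, ‖P y * (kernelPhi φ ℓ h L x y : ℂ) - q y‖ ≤
      (c₁ * L ^ α) ^ 2 * e * D := by
    intro y
    have e1 : P y * (kernelPhi φ ℓ h L x y : ℂ) - q y =
        ∑ j ∈ s, ∑ k ∈ s, a j k * ((φ j y : ℂ) * (φ k y : ℂ) - Q j k y) := by
      have e2 : P y = ∑ j ∈ s, coeff μ φ P j * (φ j y : ℂ) :=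
        congrFun (eq_sum_coeff_of_mem_diffPoly hsys hP) y
      rw [e2, kernelPhi_eq_sum hsys hh hL0]
      push_cast
      rw [Finset.sum_mul_sum, hq]
      simp only [Finset.sum_apply, Pi.smul_apply, smul_eq_mul, ← Finset.sum_sub_distrib]
      refine Finset.sum_congr rfl fun j _ => ?_
      rw [← hs, ← Finset.sum_sub_distrib]
      refine Finset.sum_congr rfl fun k _ => ?_
      simp only [ha]; push_cast; ring
    rw [e1]
    calc _ ≤ ∑ j ∈ s, ∑ k ∈ s, D * |φ k x| * e := by
          refine (norm_sum_le _ _).trans (Finset.sum_le_sum fun j hj =>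
            (norm_sum_le _ _).trans (Finset.sum_le_sum fun k hk' => ?_))
          rw [norm_mul, norm_mul, Complex.norm_real, norm_mul, Real.norm_eq_abs, Real.norm_eq_abs]
          have h0 := hsys.ell_nonneg k
          have hh0 := hh.nonneg (t := ℓ k / L) (by positivity)
          have hh1 := hh.le_one (t := ℓ k / L) (by positivity)
          rw [abs_of_nonneg hh0]
          have e3 := norm_coeff_le hsys hD j
          have e4 := hQb j k hj hk' y
          calc _ ≤ D * (1 * |φ k x|) * e := by gcongr
            _ = _ := by ring
      _ = s.card * D * e * ∑ k ∈ s, |φ k x| := by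
          rw [Finset.sum_const, nsmul_eq_mul, ← Finset.sum_mul, ← Finset.mul_sum]; ring
      _ ≤ (c₁ * L ^ α) * D * e * (c₁ * L ^ α) := by gcongr
      _ = _ := by ring
  set E := (c₁ * L ^ α) ^ 2 * e * D with hE
  have hE0 : 0 ≤ E := by positivity
  have hPk : Continuous fun y => P y * (kernelPhi φ ℓ h L x y : ℂ) := hPc.mul hk
  have h1 : ‖(∫ᵛ y, P y * (kernelPhi φ ℓ h L x y : ℂ) ∂<•ν) - ∫ᵛ y, q y ∂<•ν‖ ≤ E * T := by
    rw [← VectorMeasure.integral_fun_sub (integrable_of_continuous hPk)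
      (integrable_of_continuous hqc), ← ENNReal.ofReal_le_ofReal_iff (by positivity), ofReal_norm]
    refine (enorm_integral_signedMeasure_le ν _).trans ?_
    calc _ ≤ ∫⁻ _, ENNReal.ofReal E ∂ν.variation := by
          refine lintegral_mono fun y => ?_
          rw [← ofReal_norm]
          exact ENNReal.ofReal_le_ofReal (hdiff y)
      _ = ENNReal.ofReal E * ν.variation Set.univ := lintegral_const _
      _ ≤ ENNReal.ofReal E * ENNReal.ofReal T := by gcongr; exact hmass L hL ν hν
      _ = _ := by rw [← ENNReal.ofReal_mul hE0]
  have h2 : ‖(∫ y, P y * (kernelPhi φ ℓ h L x y : ℂ) ∂μ) - ∫ y, q y ∂μ‖ ≤ E := by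
    rw [← integral_sub (integrable_of_continuous hPk) (integrable_of_continuous hqc)]
    simpa using norm_integral_le_of_norm_le_const (μ := μ) (ae_of_all _ hdiff)
  have h3 : multOp μ φ s (fun j => h (ℓ j / L)) P x =
      ∫ y, P y * (kernelPhi φ ℓ h L x y : ℂ) ∂μ := by
    rw [multOp_eq_integral hsys _ _ hPc]
    simp only [kernelPhi_eq_sum hsys hh hL0, hs]
  have h4 := hquad q hqmem
  have hLp : (L ^ α) ^ 2 * L ^ (-(2 * α + r)) = L ^ (-r) := by
    rw [← Real.rpow_natCast (L ^ α), ← Real.rpow_mul hL0.le, ← Real.rpow_add hL0]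
    congr 1; push_cast; ring
  calc _ = ‖((∫ᵛ y, P y * (kernelPhi φ ℓ h L x y : ℂ) ∂<•ν) - ∫ᵛ y, q y ∂<•ν) -
        ((∫ y, P y * (kernelPhi φ ℓ h L x y : ℂ) ∂μ) - ∫ y, q y ∂μ)‖ := by
        rw [h3, sigmaOp, h4]; congr 1; ring
    _ ≤ E * T + E := (norm_sub_le _ _).trans (add_le_add h1 h2)
    _ = c₁ ^ 2 * c₂ * (T + 1) * ((L ^ α) ^ 2 * L ^ (-(2 * α + r))) * D := by
        rw [hE, he]; ring
    _ = _ := by rw [hLp]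

end SignedMeasure

end

/-! ### Approximation by the discretized operators -/

section

variable {X : Type*} [MetricSpace X] [CompactSpace X] [MeasurableSpace X] [BorelSpace X]
  {μ : Measure X} [IsProbabilityMeasure μ] {φ : ℕ → X → ℝ} {ℓ : ℕ → ℝ} {α : ℝ}

/-- The direct estimate for `σ_L(ν)`: compare `f` with the polynomial `P = σ_{L/2}(μ; f)`. -/
lemma HeatBound.exists_sigmaOp_direct (hsys : IsDiffusionSystem μ φ ℓ) (hα : 0 < α)
    (hball : BallMeasureCond μ α) {C κ : ℝ} (hC : 0 < C) (hκ : 0 < κ) (hH : HeatBound φ ℓ α C κ)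
    {A : ℝ} (hprod : ProductAssumption μ φ ℓ A) {h : ℝ → ℝ} (hh : IsFilter h) {r : ℝ} (hr : 0 < r)
    (N : ℝ) {M₀ : ℝ} (hM₀ : 0 < M₀) :
    ∃ c : ℝ, 0 < c ∧ ∀ L : ℝ, M₀ ≤ L → ∀ ν : SignedMeasure X, IsRegularMeasure μ α (1 / L) N ν →
      IsQuadratureMeasure μ φ ℓ (A * L) ν → ∀ f g : X → ℂ, IsDeltaStar μ φ ℓ r f g →
      ∀ D D' : ℝ, (∀ x, ‖f x‖ ≤ D) → (∀ x, ‖g x‖ ≤ D') →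
      ∀ x, ‖f x - sigmaOp φ ℓ h L ν f x‖ ≤ c * L ^ (-r) * (D + D') := by
  have : Nonempty X := nonempty_of_isProbabilityMeasure μ
  have hM₂ : 0 < M₀ / 2 := by positivity
  obtain ⟨T, hT, hmass⟩ := hball.exists_variation_univ_le hα N hM₀
  obtain ⟨c₁, hc₁, hlow⟩ := hH.exists_lowPass_bound hsys hα hball hC hκ hh hM₂
  obtain ⟨c₂, hc₂, hdir⟩ := hH.exists_direct hsys hα hball hC hκ hh hr hM₂
  obtain ⟨c₃, hc₃, hquad⟩ := hH.exists_quadrature_error hsys hα hball hC hκ hprod hh hr N hM₀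
  obtain ⟨c₄, hc₄, hsig⟩ := hH.exists_sigmaOp_bound hsys hα hball hC hκ hh N hM₀
  refine ⟨(1 + c₄) * c₂ * 2 ^ r + c₃ * c₁, by positivity,
    fun L hL ν hν hνq f g hfg D D' hD hD' x => ?_⟩
  have hL0 : 0 < L := hM₀.trans_le hL
  have hD0 : 0 ≤ D := (norm_nonneg _).trans (hD x)
  have hD0' : 0 ≤ D' := (norm_nonneg _).trans (hD' x)
  have hfin : IsFiniteMeasure ν.variation :=
    ⟨(hmass L hL ν hν).trans_lt ENNReal.ofReal_lt_top⟩
  have hL2 : M₀ / 2 ≤ L / 2 := by linarith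
  have hL20 : 0 < L / 2 := by positivity
  set P := multOp μ φ (lowFreq ℓ (L / 2)) (fun j => h (ℓ j / (L / 2))) f with hP
  have hPm : P ∈ diffPoly φ ℓ (L / 2) :=
    multOp_mem_diffPoly (fun j hj => hsys.mem_lowFreq.1 hj) _ _
  have hPm' : P ∈ diffPoly φ ℓ L :=
    multOp_mem_diffPoly (fun j hj => (hsys.mem_lowFreq.1 hj).trans (by linarith)) _ _
  have hPc := continuous_of_mem_diffPoly hsys hPm
  have hfc := hfg.left_mem.1
  have hPD : ∀ y, ‖P y‖ ≤ c₁ * D := hlow (L / 2) hL2 f hfc D hD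
  have hfP : ∀ y, ‖f y - P y‖ ≤ c₂ * 2 ^ r * L ^ (-r) * D' := fun y => by
    refine (hdir (L / 2) hL2 f g hfg D' hD' y).trans_eq ?_
    rw [Real.div_rpow hL0.le (by norm_num), Real.rpow_neg (by norm_num : (0 : ℝ) ≤ 2)]
    field_simp
  have hfix : multOp μ φ (lowFreq ℓ L) (fun j => h (ℓ j / L)) P = P := by
    refine multOp_eq_self hsys hPm (fun j hj => ?_) fun j hj => ?_
    · rw [hsys.mem_lowFreq] at hj ⊢; linarith
    · have := hsys.ell_nonneg j
      apply hh.eq_one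
      rw [abs_of_nonneg (by positivity), div_le_iff₀ hL0]
      linarith
  have h1 := hquad L hL ν hν hνq P hPm' _ hPD x
  rw [hfix] at h1
  have h2 := hsig L hL ν hν _ _ hfP x
  rw [sigmaOp_sub hsys hh hL0 ν hfc hPc] at h2
  calc _ = ‖(f x - P x) - (sigmaOp φ ℓ h L ν P x - P x) -
        (sigmaOp φ ℓ h L ν f x - sigmaOp φ ℓ h L ν P x)‖ := by congr 1; ring
    _ ≤ c₂ * 2 ^ r * L ^ (-r) * D' + c₃ * L ^ (-r) * (c₁ * D) +
        c₄ * (c₂ * 2 ^ r * L ^ (-r) * D') :=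
      (norm_sub_le _ _).trans (add_le_add ((norm_sub_le _ _).trans (add_le_add (hfP x) h1)) h2)
    _ = ((1 + c₄) * c₂ * 2 ^ r) * L ^ (-r) * D' + c₃ * c₁ * L ^ (-r) * D := by ring
    _ ≤ ((1 + c₄) * c₂ * 2 ^ r + c₃ * c₁) * L ^ (-r) * D' +
        ((1 + c₄) * c₂ * 2 ^ r + c₃ * c₁) * L ^ (-r) * D := by
      have e1 : 0 ≤ c₃ * c₁ := by positivity
      have e2 : 0 ≤ (1 + c₄) * c₂ * 2 ^ r := by positivity
      gcongr <;> linarith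
    _ = _ := by ring

/-- `(Δ^*)^r` of a diffusion polynomial. -/
lemma isDeltaStar_of_mem_diffPoly (hsys : IsDiffusionSystem μ φ ℓ) {L : ℝ} (r : ℝ) {P : X → ℂ}
    (hP : P ∈ diffPoly φ ℓ L) :
    IsDeltaStar μ φ ℓ r P (multOp μ φ (lowFreq ℓ L) (fun j => (1 + ℓ j) ^ r) P) := by
  refine ⟨mem_XInf_of_mem_diffPoly hsys hP, mem_XInf_of_mem_diffPoly hsys
    (multOp_mem_diffPoly (fun j hj => hsys.mem_lowFreq.1 hj) _ _), fun k => ?_⟩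
  have h1 := coeff_sum (μ := μ) hsys (lowFreq ℓ L)
    (fun j => (((1 + ℓ j) ^ r : ℝ) : ℂ) * coeff μ φ P j) k
  refine h1.trans ?_
  split_ifs with hk
  · rfl
  · rw [hsys.mem_lowFreq, not_le] at hk
    rw [coeff_eq_zero_of_mem_diffPoly hsys hP hk, mul_zero]

/-- The two halves of the `K`-functional estimate, for one competitor `f₁` with
`g₁ = (Δ^*)^r f₁`. -/
lemma HeatBound.exists_sigmaOp_realization (hsys : IsDiffusionSystem μ φ ℓ) (hα : 0 < α)
    (hball : BallMeasureCond μ α) {C κ : ℝ} (hC : 0 < C) (hκ : 0 < κ) (hH : HeatBound φ ℓ α C κ)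
    {A : ℝ} (hprod : ProductAssumption μ φ ℓ A) {h : ℝ → ℝ} (hh : IsFilter h) {r : ℝ} (hr : 0 < r)
    (N : ℝ) {M₀ : ℝ} (hM₀ : 0 < M₀) :
    ∃ c : ℝ, 0 < c ∧ ∀ L : ℝ, M₀ ≤ L → ∀ ν : SignedMeasure X, IsRegularMeasure μ α (1 / L) N ν →
      IsQuadratureMeasure μ φ ℓ (A * L) ν → ∀ f : X → ℂ, Continuous f →
      ∀ f₁ g₁ : X → ℂ, IsDeltaStar μ φ ℓ r f₁ g₁ → ∀ D D₁ D₂ : ℝ, (∀ x, ‖f x‖ ≤ D) →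
      (∀ x, ‖f x - f₁ x‖ ≤ D₁) → (∀ x, ‖g₁ x‖ ≤ D₂) → ∀ x,
      ‖f x - sigmaOp φ ℓ h L ν f x‖ ≤ c * (D₁ + L ^ (-r) * D₂ + L ^ (-r) * D) ∧
      ‖multOp μ φ (lowFreq ℓ L) (fun j => (1 + ℓ j) ^ r) (sigmaOp φ ℓ h L ν f) x‖ ≤
        c * L ^ r * (D₁ + L ^ (-r) * D₂ + L ^ (-r) * D) := by
  have : Nonempty X := nonempty_of_isProbabilityMeasure μ
  obtain ⟨T, hT, hmass⟩ := hball.exists_variation_univ_le hα N hM₀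
  obtain ⟨c₁, hc₁, hlow⟩ := hH.exists_lowPass_bound hsys hα hball hC hκ hh hM₀
  obtain ⟨c₂, hc₂, hdir⟩ := hH.exists_direct hsys hα hball hC hκ hh hr hM₀
  obtain ⟨c₃, hc₃, hsdir⟩ := hH.exists_sigmaOp_direct hsys hα hball hC hκ hprod hh hr N hM₀
  obtain ⟨c₄, hc₄, hsig⟩ := hH.exists_sigmaOp_bound hsys hα hball hC hκ hh N hM₀
  obtain ⟨c₅, hc₅, hbern⟩ := hH.exists_bernstein hsys hα hball hC hκ hh hr hM₀
  set c₆ : ℝ := 1 + c₄ + c₃ * (1 + M₀ ^ (-r)) with hc₆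
  have hc₆0 : 0 < c₆ := by positivity
  refine ⟨c₆ + c₅ * (c₆ + 1 + c₂) + c₁, by positivity,
    fun L hL ν hν hνq f hfc f₁ g₁ hfg D D₁ D₂ hD hD₁ hD₂ => ?_⟩
  have hL0 : 0 < L := hM₀.trans_le hL
  obtain ⟨x₀⟩ := ‹Nonempty X›
  have hD0 : 0 ≤ D := (norm_nonneg _).trans (hD x₀)
  have hD₁0 : 0 ≤ D₁ := (norm_nonneg _).trans (hD₁ x₀)
  have hD₂0 : 0 ≤ D₂ := (norm_nonneg _).trans (hD₂ x₀)
  have hfin : IsFiniteMeasure ν.variation :=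
    ⟨(hmass L hL ν hν).trans_lt ENNReal.ofReal_lt_top⟩
  have hf₁c := hfg.left_mem.1
  have hLr : 0 < L ^ (-r) := by positivity
  have hLr0 : L ^ (-r) ≤ M₀ ^ (-r) := Real.rpow_le_rpow_of_nonpos hM₀ hL (by linarith)
  have hLL : L ^ r * L ^ (-r) = 1 := by rw [← Real.rpow_add hL0]; simp
  set E : ℝ := D₁ + L ^ (-r) * D₂ + L ^ (-r) * D with hE
  have hE0 : 0 ≤ E := by positivity
  have hE1 : D₁ ≤ E := by
    have : 0 ≤ L ^ (-r) * D₂ + L ^ (-r) * D := by positivity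
    linarith
  have hE2 : L ^ (-r) * D₂ ≤ E := by
    have : 0 ≤ D₁ + L ^ (-r) * D := by positivity
    linarith
  have hf₁D : ∀ y, ‖f₁ y‖ ≤ D + D₁ := fun y => by
    calc ‖f₁ y‖ = ‖f y - (f y - f₁ y)‖ := by congr 1; ring
      _ ≤ D + D₁ := (norm_sub_le _ _).trans (add_le_add (hD y) (hD₁ y))
  have happrox : ∀ y, ‖f y - sigmaOp φ ℓ h L ν f y‖ ≤ c₆ * E := by
    intro y
    have h1 := hsdir L hL ν hν hνq f₁ g₁ hfg _ _ hf₁D hD₂ y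
    have h2 := hsig L hL ν hν _ _ hD₁ y
    rw [sigmaOp_sub hsys hh hL0 ν hfc hf₁c] at h2
    have h3 : L ^ (-r) * (D + D₁ + D₂) ≤ (1 + M₀ ^ (-r)) * E := by
      have e1 : L ^ (-r) * D₁ ≤ M₀ ^ (-r) * E := by gcongr
      have e2 : L ^ (-r) * (D + D₂) ≤ E := by rw [hE]; linarith
      linarith
    calc _ = ‖(f y - f₁ y) + (f₁ y - sigmaOp φ ℓ h L ν f₁ y) -
          (sigmaOp φ ℓ h L ν f y - sigmaOp φ ℓ h L ν f₁ y)‖ := by congr 1; ring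
      _ ≤ D₁ + c₃ * L ^ (-r) * (D + D₁ + D₂) + c₄ * D₁ :=
        (norm_sub_le _ _).trans (add_le_add ((norm_add_le _ _).trans (add_le_add (hD₁ y) h1)) h2)
      _ = (1 + c₄) * D₁ + c₃ * (L ^ (-r) * (D + D₁ + D₂)) := by ring
      _ ≤ (1 + c₄) * E + c₃ * ((1 + M₀ ^ (-r)) * E) := by gcongr
      _ = _ := by rw [hc₆]; ring
  intro x
  constructor
  · refine (happrox x).trans ?_
    gcongr
    have : 0 ≤ c₅ * (c₆ + 1 + c₂) + c₁ := by positivity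
    linarith
  -- `(Δ^*)^r σ_L(ν; f) = (Δ^*)^r (σ_L(ν; f) - S) + σ_L(μ; g₁)` with `S = σ_L(μ; f₁)`: Bernstein's
  -- inequality applies to the first term.
  set S := multOp μ φ (lowFreq ℓ L) (fun j => h (ℓ j / L)) f₁ with hS
  have hσm := sigmaOp_mem_diffPoly hsys hh hL0 ν hfc
  have hSm : S ∈ diffPoly φ ℓ L := multOp_mem_diffPoly (fun j hj => hsys.mem_lowFreq.1 hj) _ _
  have hσc := continuous_of_mem_diffPoly hsys hσm
  have hSc := continuous_of_mem_diffPoly hsys hSm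
  have hWm : (fun y => sigmaOp φ ℓ h L ν f y - S y) ∈ diffPoly φ ℓ L :=
    Submodule.sub_mem _ hσm hSm
  have hWD : ∀ y, ‖sigmaOp φ ℓ h L ν f y - S y‖ ≤ (c₆ + 1 + c₂) * E := by
    intro y
    have h1 := hdir L hL f₁ g₁ hfg D₂ hD₂ y
    calc _ = ‖(f y - f₁ y) + (f₁ y - S y) - (f y - sigmaOp φ ℓ h L ν f y)‖ := by congr 1; ring
      _ ≤ D₁ + c₂ * L ^ (-r) * D₂ + c₆ * E :=
        (norm_sub_le _ _).trans (add_le_add ((norm_add_le _ _).trans (add_le_add (hD₁ y) h1))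
          (happrox y))
      _ = D₁ + c₂ * (L ^ (-r) * D₂) + c₆ * E := by ring
      _ ≤ E + c₂ * E + c₆ * E := by gcongr
      _ = _ := by ring
  have hW := hbern L hL _ hWm _ hWD x
  rw [multOp_sub hsys _ _ hσc hSc] at hW
  have hSg : multOp μ φ (lowFreq ℓ L) (fun j => (1 + ℓ j) ^ r) S x =
      multOp μ φ (lowFreq ℓ L) (fun j => h (ℓ j / L)) g₁ x := by
    refine Finset.sum_congr rfl fun j hj => ?_
    have h1 : coeff μ φ S j = (h (ℓ j / L) : ℂ) * coeff μ φ f₁ j := by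
      have := coeff_sum (μ := μ) hsys (lowFreq ℓ L)
        (fun j => ((h (ℓ j / L) : ℝ) : ℂ) * coeff μ φ f₁ j) j
      rwa [if_pos hj] at this
    rw [h1, hfg.coeff_eq]; ring
  rw [hSg] at hW
  have hg := hlow L hL g₁ hfg.right_mem.1 D₂ hD₂ x
  have hD₂E : D₂ ≤ L ^ r * E := by
    calc D₂ = L ^ r * (L ^ (-r) * D₂) := by rw [← mul_assoc, hLL, one_mul]
      _ ≤ L ^ r * E := by gcongr
  calc _ = ‖(multOp μ φ (lowFreq ℓ L) (fun j => (1 + ℓ j) ^ r) (sigmaOp φ ℓ h L ν f) x -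
        multOp μ φ (lowFreq ℓ L) (fun j => h (ℓ j / L)) g₁ x) +
        multOp μ φ (lowFreq ℓ L) (fun j => h (ℓ j / L)) g₁ x‖ := by congr 1; ring
    _ ≤ c₅ * L ^ r * ((c₆ + 1 + c₂) * E) + c₁ * D₂ := (norm_add_le _ _).trans (add_le_add hW hg)
    _ ≤ c₅ * L ^ r * ((c₆ + 1 + c₂) * E) + c₁ * (L ^ r * E) := by gcongr
    _ = (c₅ * (c₆ + 1 + c₂) + c₁) * L ^ r * E := by ring
    _ ≤ _ := by gcongr; linarith

end

end DiffusionApprox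

end

theorem proposition5p3 {n : ℕ} {X : Type*} [MetricSpace X]
    [ChartedSpace (EuclideanSpace ℝ (Fin n)) X] [IsManifold (𝓡 n) ∞ X]
    [RiemannianBundle (fun x : X => TangentSpace (𝓡 n) x)]
    [IsContMDiffRiemannianBundle (𝓡 n) ∞ (EuclideanSpace ℝ (Fin n))
      (fun x : X => TangentSpace (𝓡 n) x)]
    [IsRiemannianManifold (𝓡 n) X] [CompactSpace X] [ConnectedSpace X]
    [MeasurableSpace X] [BorelSpace X] (μ : Measure X) [IsProbabilityMeasure μ]
    (φ : ℕ → X → ℝ) (ℓ : ℕ → ℝ) (hsys : IsDiffusionSystem μ φ ℓ)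
    (α : ℝ) (hα : 0 < α) (hball : BallMeasureCond μ α) (hheat : GaussianUpperBound φ ℓ α)
    (A : ℝ) (hprod : ProductAssumption μ φ ℓ A)
    (h : ℝ → ℝ) (hh : IsFilter h)
    (r : ℝ) (hr : 0 < r) (N : ℝ) (L₀ : ℝ) (hL₀ : 0 < L₀) :
    ∃ c : ℝ, 0 < c ∧ ∀ L : ℝ, L₀ ≤ L → ∀ ν : SignedMeasure X,
      IsRegularMeasure μ α (1 / L) N ν → IsQuadratureMeasure μ φ ℓ (A * L) ν →
      (∀ f g : X → ℂ, IsDeltaStar μ φ ℓ r f g →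
        eLpNorm (fun x => f x - sigmaOp φ ℓ h L ν f x) ∞ μ ≤
          ENNReal.ofReal (c * L ^ (-r)) * (eLpNorm f ∞ μ + eLpNorm g ∞ μ)) ∧
      (∀ f ∈ XInf μ φ ℓ, ∃ g : X → ℂ, IsDeltaStar μ φ ℓ r (sigmaOp φ ℓ h L ν f) g ∧
        eLpNorm (fun x => f x - sigmaOp φ ℓ h L ν f x) ∞ μ +
            ENNReal.ofReal (L ^ (-r)) * eLpNorm g ∞ μ ≤
          ENNReal.ofReal c *
            (kFunctional μ φ ℓ r f (1 / L) + ENNReal.ofReal (L ^ (-r)) * eLpNorm f ∞ μ)) := by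
  obtain ⟨C, κ, hC, hκ, hH⟩ := hheat
  change HeatBound φ ℓ α C κ at hH
  have hpos := hH.isOpenPosMeasure hsys hκ
  obtain ⟨T, hT, hmass⟩ := hball.exists_variation_univ_le hα N hL₀
  obtain ⟨c₁, hc₁, hdir⟩ := hH.exists_sigmaOp_direct hsys hα hball hC hκ hprod hh hr N hL₀
  obtain ⟨c₂, hc₂, hreal⟩ := hH.exists_sigmaOp_realization hsys hα hball hC hκ hprod hh hr N hL₀
  refine ⟨c₁ + 2 * c₂, by positivity, fun L hL ν hν hνq => ?_⟩
  have hL0 : 0 < L := hL₀.trans_le hL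
  have hfin : IsFiniteMeasure ν.variation :=
    ⟨(hmass L hL ν hν).trans_lt ENNReal.ofReal_lt_top⟩
  have hσm : ∀ f : X → ℂ, Continuous f → sigmaOp φ ℓ h L ν f ∈ diffPoly φ ℓ L := fun f hf =>
    sigmaOp_mem_diffPoly hsys hh hL0 ν hf
  have hdc : ∀ f : X → ℂ, Continuous f → Continuous fun x => f x - sigmaOp φ ℓ h L ν f x :=
    fun f hf => hf.sub (continuous_of_mem_diffPoly hsys (hσm f hf))
  have hLr : 0 < L ^ (-r) := by positivity
  constructor
  · intro f g hfg
    obtain ⟨D, hD0, hDe, hD⟩ := exists_eLpNorm_top_eq (μ := μ) hfg.left_mem.1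
    obtain ⟨D', hD0', hDe', hD'⟩ := exists_eLpNorm_top_eq (μ := μ) hfg.right_mem.1
    rw [hDe, hDe', ← ENNReal.ofReal_add hD0 hD0', ← ENNReal.ofReal_mul (by positivity),
      eLpNorm_top_le_iff (hdc f hfg.left_mem.1) (by positivity)]
    intro x
    refine (hdir L hL ν hν hνq f g hfg D D' hD hD' x).trans ?_
    gcongr
    linarith
  · intro f hf
    have hfc := hf.1
    have hstar := isDeltaStar_of_mem_diffPoly hsys r (hσm f hfc)
    refine ⟨_, hstar, ?_⟩
    obtain ⟨D, hD0, hDe, hD⟩ := exists_eLpNorm_top_eq (μ := μ) hfc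
    have hc0 : ENNReal.ofReal (c₁ + 2 * c₂) ≠ 0 := by
      rw [Ne, ENNReal.ofReal_eq_zero, not_le]; positivity
    -- The `K`-functional is isolated, so that it suffices to treat each competitor.
    rw [← ENNReal.div_le_iff' hc0 ENNReal.ofReal_ne_top, ← tsub_le_iff_right]
    refine le_iInf fun f₁ => le_iInf fun g₁ => le_iInf fun hfg => ?_
    rw [tsub_le_iff_right, ENNReal.div_le_iff' hc0 ENNReal.ofReal_ne_top]
    have hsub : Continuous fun x => f x - f₁ x := hfc.sub hfg.left_mem.1
    obtain ⟨D₁, hD₁0, hD₁e, hD₁⟩ := exists_eLpNorm_top_eq (μ := μ) hsub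
    obtain ⟨D₂, hD₂0, hD₂e, hD₂⟩ := exists_eLpNorm_top_eq (μ := μ) hfg.right_mem.1
    have hkey := hreal L hL ν hν hνq f hfc f₁ g₁ hfg D D₁ D₂ hD hD₁ hD₂
    have hL' : (1 / L) ^ r = L ^ (-r) := by
      rw [one_div, Real.inv_rpow hL0.le, Real.rpow_neg hL0.le]
    set E : ℝ := D₁ + L ^ (-r) * D₂ + L ^ (-r) * D with hE
    have hE0 : 0 ≤ E := by positivity
    have e1 := (eLpNorm_top_le_iff (μ := μ) (hdc f hfc) (by positivity)).2 fun x => (hkey x).1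
    have e2 := (eLpNorm_top_le_iff (μ := μ) hstar.right_mem.1 (by positivity)).2
      fun x => (hkey x).2
    rw [hL', hD₁e, hD₂e, hDe, ← ENNReal.ofReal_mul hLr.le, ← ENNReal.ofReal_mul hLr.le,
      ← ENNReal.ofReal_add hD₁0 (by positivity), ← ENNReal.ofReal_add (by positivity)
      (by positivity), ← ENNReal.ofReal_mul (by positivity)]
    refine (add_le_add e1 (mul_le_mul_right e2 _)).trans ?_
    rw [← ENNReal.ofReal_mul hLr.le, ← ENNReal.ofReal_add (by positivity) (by positivity)]
    apply ENNReal.ofReal_le_ofReal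
    have hLL : L ^ (-r) * L ^ r = 1 := by rw [← Real.rpow_add hL0]; simp
    calc _ = c₂ * E + c₂ * (L ^ (-r) * L ^ r) * E := by ring
      _ = 2 * c₂ * E := by rw [hLL]; ring
      _ ≤ _ := by gcongr; linarith
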